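/- Let $\mathbb{K}\in\{\mathbb{R},\mathbb{C}\}$, let $\alpha>0$ and $\beta,\gamma,\kappa\in\mathbb{R}$, and put $\mathbb{R}_+=(0,\infty)$. On the Hilbert space $L^2(\mathbb{R}_+)$ of $\mathbb{K}$-valued functions consider the Robin reaction--diffusion--transport operator $$A_R u=\alpha u''+\beta u'+\gamma u,\qquad D(A_R)=\{u\in H^2(\mathbb{R}_+):\ u'(0)+\kappa u(0)=0\},$$ where the derivatives are weak derivatives and $u(0)$, $u'(0)$ are the values at $0$ of the representatives of $u$, $u'$ that are continuous on $[0,\infty)$. Then $A_R$ is densely defined and closed, and it generates a strongly continuous semigroup on $L^2(\mathbb{R}_+)$; that is, there is a family $(T(t))_{t\ge 0}$ of bounded linear operators on $L^2(\mathbb{R}_+)$ with $T(0)=I$, $T(t+s)=T(t)T(s)$ for all $s,t\ge 0$, and $t\mapsto T(t)u$ continuous on $[0,\infty)$ for every $u\in L^2(\mathbb{R}_+)$, such that $$D(A_R)=\Bigl\{u\in L^2(\mathbb{R}_+):\ \lim_{t\downarrow 0}\tfrac{T(t)u-u}{t}\ \text{exists in } L^2(\mathbb{R}_+)\Bigr\},\qquad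 A_R u=\lim_{t\downarrow 0}\frac{T(t)u-u}{t}\quad (u\in D(A_R)).$$ -/

import Mathlib

open MeasureTheory Set Filter Topology
open scoped NNReal ContDiff

noncomputable section

/-! ## Strongly continuous semigroups and their generators -/

section Semigroup

variable {𝕜 X : Type*} [RCLike 𝕜] [NormedAddCommGroup X] [NormedSpace 𝕜 X]

/-- A strongly continuous semigroup (`C₀`-semigroup) of bounded operators on `X`. -/
structure IsC0Semigroup (T : ℝ≥0 → X →L[𝕜] X) : Prop where
  map_zero : T 0 = ContinuousLinearMap.id 𝕜 X
  map_add : ∀ s t : ℝ≥0, T (t + s) = (T t).comp (T s)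
  continuous_orbit : ∀ x : X, Continuous fun t : ℝ≥0 => T t x

/-- `y` is the limit of `(T(t)x - x)/t` as `t ↓ 0`. -/
def HasGeneratorValue (T : ℝ≥0 → X →L[𝕜] X) (x y : X) : Prop :=
  Tendsto (fun t : ℝ≥0 => (((t : ℝ) : 𝕜))⁻¹ • (T t x - x)) (𝓝[>] 0) (𝓝 y)

/-- The generator of `T`, as an unbounded operator: `Ax = lim_{t ↓ 0} (T(t)x - x)/t`, its domain
being the set of all `x` for which this limit exists. -/
def semigroupGenerator (T : ℝ≥0 → X →L[𝕜] X) : X →ₗ.[𝕜] X where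
  domain :=
    { carrier := {x | ∃ y, HasGeneratorValue T x y}
      zero_mem' := ⟨0, by simp [HasGeneratorValue]⟩
      add_mem' := by
        rintro a b ⟨y, hy⟩ ⟨z, hz⟩
        refine ⟨y + z, (hy.add hz).congr fun t => ?_⟩
        rw [map_add, ← smul_add]
        congr 1
        abel
      smul_mem' := by
        rintro c a ⟨y, hy⟩
        refine ⟨c • y, (hy.const_smul c).congr fun t => ?_⟩
        rw [map_smul, ← smul_sub, smul_comm] }
  toFun :=
    { toFun := fun x => x.2.choose
      map_add' := by
        intro a b
        refine tendsto_nhds_unique (a + b).2.choose_spec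
          ((a.2.choose_spec.add b.2.choose_spec).congr fun t => ?_)
        rw [Submodule.coe_add, map_add, ← smul_add]
        congr 1
        abel
      map_smul' := by
        intro c a
        refine tendsto_nhds_unique (c • a).2.choose_spec
          ((a.2.choose_spec.const_smul c).congr fun t => ?_)
        rw [Submodule.coe_smul, map_smul, ← smul_sub, smul_comm] }

/-- The unbounded operator `A` generates a `C₀`-semigroup: it is the generator of one. -/
def GeneratesC0Semigroup (A : X →ₗ.[𝕜] X) : Prop :=
  ∃ T : ℝ≥0 → X →L[𝕜] X, IsC0Semigroup T ∧ semigroupGenerator T = A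

end Semigroup

/-! ## Sobolev spaces and traces on the half-line -/

namespace HalfLine

/-- `L²(ℝ₊)` with `ℝ₊ = (0, ∞)` and values in `𝕜 = ℝ` or `ℂ`. -/
abbrev L2 (𝕜 : Type*) [RCLike 𝕜] : Type _ :=
  Lp 𝕜 2 ((volume : Measure ℝ).restrict (Ioi 0))

variable {𝕜 : Type*} [RCLike 𝕜]

/-- `v` is the weak derivative of `u` on `(0, ∞)`: `∫ φ' u = - ∫ φ v` for all `φ ∈ C_c^∞(0, ∞)`. -/
def IsWeakDeriv (u v : L2 𝕜) : Prop :=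
  ∀ φ : ℝ → ℝ, ContDiff ℝ ∞ φ → HasCompactSupport φ → tsupport φ ⊆ Ioi 0 →
    ∫ x in Ioi (0 : ℝ), deriv φ x • u x = -∫ x in Ioi (0 : ℝ), φ x • v x

/-- `u` has boundary value (trace) `a` at `0`: `u` agrees almost everywhere on `(0, ∞)` with a
function that is continuous on `[0, ∞)` and takes the value `a` at `0`. -/
def HasTrace (u : L2 𝕜) (a : 𝕜) : Prop :=
  ∃ f : ℝ → 𝕜, ContinuousOn f (Ici 0) ∧ (∀ᵐ x ∂(volume.restrict (Ioi (0 : ℝ))), u x = f x) ∧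
    f 0 = a

open Classical in
/-- The weak derivative `u'`, where it exists in `L²(ℝ₊)` (and `0` otherwise). -/
def weakDeriv (u : L2 𝕜) : L2 𝕜 :=
  if h : ∃ v, IsWeakDeriv u v then h.choose else 0

open Classical in
/-- The boundary value `u(0)`, where it exists (and `0` otherwise). -/
def trace (u : L2 𝕜) : 𝕜 :=
  if h : ∃ a, HasTrace u a then h.choose else 0

/-! ### Linearity and uniqueness of weak derivatives -/

lemma locallyIntegrableOn_L2 (u : L2 𝕜) : LocallyIntegrableOn (u : ℝ → 𝕜) (Ioi 0) volume := by
  have h : LocallyIntegrable (u : ℝ → 𝕜) (volume.restrict (Ioi 0)) :=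
    (Lp.memLp u).locallyIntegrable (by norm_num)
  exact locallyIntegrableOn_of_locallyIntegrable_restrict h

lemma integrable_smul_L2 (u : L2 𝕜) {φ : ℝ → ℝ} (hφ : Continuous φ) (hc : HasCompactSupport φ) :
    Integrable (fun x => φ x • u x) (volume.restrict (Ioi 0)) := by
  have h : LocallyIntegrable (u : ℝ → 𝕜) (volume.restrict (Ioi 0)) :=
    (Lp.memLp u).locallyIntegrable (by norm_num)
  exact h.integrable_smul_left_of_hasCompactSupport hφ hc

lemma IsWeakDeriv.unique {u v w : L2 𝕜} (hv : IsWeakDeriv u v) (hw : IsWeakDeriv u w) :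
    v = w := by
  have key : ∀ᵐ x ∂(volume : Measure ℝ), x ∈ Ioi (0 : ℝ) → (v x - w x) = 0 := by
    refine isOpen_Ioi.ae_eq_zero_of_integral_contDiff_smul_eq_zero
      ((locallyIntegrableOn_L2 v).sub (locallyIntegrableOn_L2 w)) fun g hg hgc hgs => ?_
    have h0 : ∫ x, g x • (v x - w x) = ∫ x in Ioi (0 : ℝ), g x • (v x - w x) := by
      refine (setIntegral_eq_integral_of_forall_compl_eq_zero fun x hx => ?_).symm
      rw [image_eq_zero_of_notMem_tsupport fun h => hx (hgs h), zero_smul]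
    change ∫ x, g x • (v x - w x) = 0
    rw [h0]
    simp_rw [smul_sub]
    rw [integral_sub (integrable_smul_L2 v hg.continuous hgc)
      (integrable_smul_L2 w hg.continuous hgc)]
    have h1 := hv g hg hgc hgs
    have h2 := hw g hg hgc hgs
    rw [h1] at h2
    rw [neg_inj.mp h2, sub_self]
  refine Lp.ext ?_
  rw [EventuallyEq, ae_restrict_iff' measurableSet_Ioi]
  filter_upwards [key] with x hx hx0
  exact sub_eq_zero.mp (hx hx0)

lemma IsWeakDeriv.weakDeriv_eq {u v : L2 𝕜} (h : IsWeakDeriv u v) : weakDeriv u = v := by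
  have hex : ∃ v, IsWeakDeriv u v := ⟨v, h⟩
  rw [weakDeriv, dif_pos hex]
  exact hex.choose_spec.unique h

lemma isWeakDeriv_zero : IsWeakDeriv (0 : L2 𝕜) 0 := by
  intro φ _ _ _
  have h : ∀ ψ : ℝ → ℝ, ∫ x in Ioi (0 : ℝ), ψ x • (0 : L2 𝕜) x = 0 := by
    intro ψ
    refine integral_eq_zero_of_ae ?_
    filter_upwards [Lp.coeFn_zero 𝕜 2 ((volume : Measure ℝ).restrict (Ioi 0))] with x hx
    rw [hx, Pi.zero_apply, smul_zero]
  rw [h, h, neg_zero]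

lemma IsWeakDeriv.add {u v u₁ v₁ : L2 𝕜} (hu : IsWeakDeriv u u₁) (hv : IsWeakDeriv v v₁) :
    IsWeakDeriv (u + v) (u₁ + v₁) := by
  intro φ hφ hc hs
  have h : ∀ ψ : ℝ → ℝ, Continuous ψ → HasCompactSupport ψ → ∀ a b : L2 𝕜,
      ∫ x in Ioi (0 : ℝ), ψ x • (a + b : L2 𝕜) x
        = (∫ x in Ioi (0 : ℝ), ψ x • a x) + ∫ x in Ioi (0 : ℝ), ψ x • b x := by
    intro ψ hψ hψc a b
    rw [← integral_add (integrable_smul_L2 a hψ hψc) (integrable_smul_L2 b hψ hψc)]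
    refine integral_congr_ae ?_
    filter_upwards [Lp.coeFn_add a b] with x hx
    rw [hx, Pi.add_apply, smul_add]
  rw [h _ (hφ.continuous_deriv (by simp)) hc.deriv, h _ hφ.continuous hc, hu φ hφ hc hs,
    hv φ hφ hc hs]
  ring

lemma IsWeakDeriv.smul {u u₁ : L2 𝕜} (c : 𝕜) (hu : IsWeakDeriv u u₁) :
    IsWeakDeriv (c • u) (c • u₁) := by
  intro φ hφ hc hs
  have h : ∀ (ψ : ℝ → ℝ) (a : L2 𝕜),
      ∫ x in Ioi (0 : ℝ), ψ x • (c • a : L2 𝕜) x = c • ∫ x in Ioi (0 : ℝ), ψ x • a x := by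
    intro ψ a
    rw [← integral_smul]
    refine integral_congr_ae ?_
    filter_upwards [Lp.coeFn_smul c a] with x hx
    simp only [hx, Pi.smul_apply]
    rw [smul_comm]
  rw [h, h, hu φ hφ hc hs, smul_neg]

/-- The Sobolev space `H¹(ℝ₊)`: all `u ∈ L²(ℝ₊)` with a weak derivative in `L²(ℝ₊)`. -/
def H1 (𝕜 : Type*) [RCLike 𝕜] : Submodule 𝕜 (L2 𝕜) where
  carrier := {u | ∃ v, IsWeakDeriv u v}
  zero_mem' := ⟨0, isWeakDeriv_zero⟩
  add_mem' := by
    rintro a b ⟨v, hv⟩ ⟨w, hw⟩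
    exact ⟨v + w, hv.add hw⟩
  smul_mem' := by
    rintro c a ⟨v, hv⟩
    exact ⟨c • v, hv.smul c⟩

lemma isWeakDeriv_weakDeriv {u : L2 𝕜} (hu : u ∈ H1 𝕜) : IsWeakDeriv u (weakDeriv u) := by
  obtain ⟨v, hv⟩ := hu
  rwa [hv.weakDeriv_eq]

lemma weakDeriv_add {u v : L2 𝕜} (hu : u ∈ H1 𝕜) (hv : v ∈ H1 𝕜) :
    weakDeriv (u + v) = weakDeriv u + weakDeriv v :=
  ((isWeakDeriv_weakDeriv hu).add (isWeakDeriv_weakDeriv hv)).weakDeriv_eq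

lemma weakDeriv_smul {u : L2 𝕜} (c : 𝕜) (hu : u ∈ H1 𝕜) :
    weakDeriv (c • u) = c • weakDeriv u :=
  ((isWeakDeriv_weakDeriv hu).smul c).weakDeriv_eq

/-- The Sobolev space `H²(ℝ₊)`: all `u ∈ L²(ℝ₊)` with weak derivatives `u', u'' ∈ L²(ℝ₊)`. -/
def H2 (𝕜 : Type*) [RCLike 𝕜] : Submodule 𝕜 (L2 𝕜) where
  carrier := {u | u ∈ H1 𝕜 ∧ weakDeriv u ∈ H1 𝕜}
  zero_mem' := by
    refine ⟨zero_mem _, ?_⟩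
    rw [isWeakDeriv_zero.weakDeriv_eq]
    exact zero_mem _
  add_mem' := by
    rintro a b ⟨ha, ha'⟩ ⟨hb, hb'⟩
    refine ⟨add_mem ha hb, ?_⟩
    rw [weakDeriv_add ha hb]
    exact add_mem ha' hb'
  smul_mem' := by
    rintro c a ⟨ha, ha'⟩
    refine ⟨Submodule.smul_mem _ c ha, ?_⟩
    rw [weakDeriv_smul c ha]
    exact Submodule.smul_mem _ c ha'

/-! ### Existence, uniqueness and linearity of traces on `H¹(ℝ₊)` -/

lemma HasTrace.unique {u : L2 𝕜} {a b : 𝕜} (ha : HasTrace u a) (hb : HasTrace u b) : a = b := by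
  obtain ⟨f, hf, hfu, rfl⟩ := ha
  obtain ⟨g, hg, hgu, rfl⟩ := hb
  have hae : ∀ᵐ x ∂(volume.restrict (Ioi (0 : ℝ))), f x = g x := by
    filter_upwards [hfu, hgu] with x h1 h2
    rw [← h1, h2]
  have heq : EqOn f g (Ioi 0) :=
    Measure.eqOn_open_of_ae_eq hae isOpen_Ioi (hf.mono Ioi_subset_Ici_self)
      (hg.mono Ioi_subset_Ici_self)
  have hcl : EqOn f g (Ici 0) :=
    heq.of_subset_closure hf hg Ioi_subset_Ici_self (by rw [closure_Ioi])
  exact hcl self_mem_Ici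

lemma HasTrace.trace_eq {u : L2 𝕜} {a : 𝕜} (h : HasTrace u a) : trace u = a := by
  have hex : ∃ a, HasTrace u a := ⟨a, h⟩
  rw [trace, dif_pos hex]
  exact hex.choose_spec.unique h

lemma hasTrace_zero : HasTrace (0 : L2 𝕜) 0 :=
  ⟨fun _ => 0, continuousOn_const, Lp.coeFn_zero 𝕜 2 _, rfl⟩

lemma HasTrace.add {u v : L2 𝕜} {a b : 𝕜} (hu : HasTrace u a) (hv : HasTrace v b) :
    HasTrace (u + v) (a + b) := by
  obtain ⟨f, hf, hfu, rfl⟩ := hu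
  obtain ⟨g, hg, hgv, rfl⟩ := hv
  refine ⟨fun x => f x + g x, hf.add hg, ?_, rfl⟩
  filter_upwards [hfu, hgv, Lp.coeFn_add u v] with x h1 h2 h3
  rw [h3, Pi.add_apply, h1, h2]

lemma HasTrace.smul {u : L2 𝕜} {a : 𝕜} (c : 𝕜) (hu : HasTrace u a) :
    HasTrace (c • u) (c * a) := by
  obtain ⟨f, hf, hfu, rfl⟩ := hu
  refine ⟨fun x => c * f x, hf.const_mul c, ?_, rfl⟩
  filter_upwards [hfu, Lp.coeFn_smul c u] with x h1 h3
  rw [h3, Pi.smul_apply, h1, smul_eq_mul]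

/-- Integration by parts against the primitive of an integrable function. -/
lemma integral_deriv_smul_primitive {V : ℝ → 𝕜} (hV : Integrable V) {φ : ℝ → ℝ}
    (hφ : ContDiff ℝ ∞ φ) (hc : HasCompactSupport φ) :
    ∫ x, deriv φ x • ∫ y in Iio x, V y = -∫ y, φ y • V y := by
  have hφ' : Continuous (deriv φ) := hφ.continuous_deriv (by simp)
  have hφi : Integrable (deriv φ) := hφ'.integrable_of_hasCompactSupport hc.deriv
  let S : Set (ℝ × ℝ) := {p | p.2 < p.1}
  have hS : MeasurableSet S := measurableSet_lt measurable_snd measurable_fst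
  let F : ℝ → ℝ → 𝕜 := fun x y => S.indicator (fun p : ℝ × ℝ => deriv φ p.1 • V p.2) (x, y)
  have hF : Integrable (Function.uncurry F) (volume.prod volume) :=
    (hφi.smul_prod hV).indicator hS
  have hswap := integral_integral_swap hF
  have h1 : ∀ x, ∫ y, F x y = deriv φ x • ∫ y in Iio x, V y := by
    intro x
    rw [← integral_smul, ← integral_indicator measurableSet_Iio]
    rfl
  have h2 : ∀ y, ∫ x, F x y = -(φ y • V y) := by
    intro y
    have : ∫ x, F x y = ∫ x in Ioi y, deriv φ x • V y := by
      rw [← integral_indicator measurableSet_Ioi]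
      rfl
    rw [this, integral_smul_const, hc.integral_Ioi_deriv_eq (hφ.of_le (by simp)) y, neg_smul]
  simp_rw [h1, h2] at hswap
  rw [hswap, integral_neg]

/-- A test function on `(0, ∞)` with integral zero is the derivative of a test function. -/
lemma exists_primitive {ψ : ℝ → ℝ} (hψ : ContDiff ℝ ∞ ψ) (hc : HasCompactSupport ψ)
    (hs : tsupport ψ ⊆ Ioi 0) (h0 : ∫ x, ψ x = 0) :
    ∃ φ : ℝ → ℝ, ContDiff ℝ ∞ φ ∧ HasCompactSupport φ ∧ tsupport φ ⊆ Ioi 0 ∧ deriv φ = ψ := by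
  obtain ⟨a, b, ha, hab⟩ : ∃ a b : ℝ, 0 < a ∧ tsupport ψ ⊆ Icc a b := by
    rcases (tsupport ψ).eq_empty_or_nonempty with he | hne
    · exact ⟨1, 1, one_pos, by simp [he]⟩
    · have hcomp : IsCompact (tsupport ψ) := hc
      refine ⟨sInf (tsupport ψ), sSup (tsupport ψ), hs (hcomp.sInf_mem hne), fun x hx => ?_⟩
      exact ⟨csInf_le hcomp.bddBelow hx, le_csSup hcomp.bddAbove hx⟩
  have hzero : ∀ x, x ∉ Icc a b → ψ x = 0 := fun x hx =>
    image_eq_zero_of_notMem_tsupport fun h => hx (hab h)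
  let φ : ℝ → ℝ := fun x => ∫ y in (0 : ℝ)..x, ψ y
  have hd : ∀ x, HasDerivAt φ (ψ x) x := fun x =>
    intervalIntegral.integral_hasDerivAt_right (hψ.continuous.intervalIntegrable _ _)
      (hψ.continuous.stronglyMeasurableAtFilter _ _) hψ.continuous.continuousAt
  have hderiv : deriv φ = ψ := funext fun x => (hd x).deriv
  have hsupp : ∀ x, x ∉ Icc a b → φ x = 0 := by
    intro x hx
    rw [mem_Icc, not_and_or, not_le, not_le] at hx
    rcases hx with hx | hx
    · have : ∀ y ∈ uIcc 0 x, ψ y = 0 := by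
        intro y hy
        refine hzero y fun h => ?_
        have : y ≤ max 0 x := hy.2
        have h3 : max 0 x < a := max_lt ha hx
        linarith [h.1]
      change ∫ y in (0 : ℝ)..x, ψ y = 0
      rw [intervalIntegral.integral_congr (g := fun _ => (0 : ℝ)) this]
      simp
    · rcases le_total x 0 with hx0 | hx0
      · have : ∀ y ∈ uIcc 0 x, ψ y = 0 := by
          intro y hy
          refine hzero y fun h => ?_
          have : y ≤ max 0 x := hy.2
          rw [max_eq_left hx0] at this
          linarith [h.1]
        change ∫ y in (0 : ℝ)..x, ψ y = 0
        rw [intervalIntegral.integral_congr (g := fun _ => (0 : ℝ)) this]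
        simp
      · change ∫ y in (0 : ℝ)..x, ψ y = 0
        rw [intervalIntegral.integral_of_le hx0]
        refine Eq.trans ?_ h0
        refine setIntegral_eq_integral_of_forall_compl_eq_zero fun y hy => hzero y fun h => hy ?_
        exact ⟨lt_of_lt_of_le ha h.1, h.2.trans hx.le⟩
  have hts : tsupport φ ⊆ Icc a b := by
    refine closure_minimal (fun x hx => ?_) isClosed_Icc
    by_contra h
    exact hx (hsupp x h)
  refine ⟨φ, ?_, ?_, hts.trans fun x hx => lt_of_lt_of_le ha hx.1, hderiv⟩
  · rw [contDiff_infty_iff_deriv]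
    exact ⟨fun x => (hd x).differentiableAt, by rwa [hderiv]⟩
  · exact isCompact_Icc.of_isClosed_subset (isClosed_tsupport φ) hts

/-- Every element of `H¹(ℝ₊)` has a trace at `0`. -/
lemma exists_hasTrace {u : L2 𝕜} (hu : u ∈ H1 𝕜) : ∃ a, HasTrace u a := by
  obtain ⟨v, hv⟩ := hu
  have hvI : ∀ R : ℝ, IntegrableOn (v : ℝ → 𝕜) (Ioc 0 R) := by
    intro R
    have h1 : MemLp (v : ℝ → 𝕜) 2 (volume.restrict (Ioc 0 R)) :=
      (Lp.memLp v).mono_measure (Measure.restrict_mono Ioc_subset_Ioi_self le_rfl)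
    exact h1.integrable (by norm_num)
  let f : ℝ → 𝕜 := fun x => ∫ y in Ioc 0 x, v y
  have hfc : ContinuousOn f (Ici 0) := by
    intro x hx
    have hx0 : (0 : ℝ) ≤ x := hx
    have h1 : ContinuousOn f (Icc 0 (x + 1)) :=
      intervalIntegral.continuousOn_primitive
        ((integrableOn_Icc_iff_integrableOn_Ioc).mpr (hvI (x + 1)))
    refine (h1 x ⟨hx0, by linarith⟩).mono_of_mem_nhdsWithin ?_
    have : Icc 0 (x + 1) = Ici 0 ∩ Iic (x + 1) := rfl
    rw [this]
    exact inter_mem self_mem_nhdsWithin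
      (mem_nhdsWithin_of_mem_nhds (Iic_mem_nhds (by linarith)))
  have hfl : LocallyIntegrableOn f (Ioi 0) volume :=
    (hfc.mono Ioi_subset_Ici_self).locallyIntegrableOn measurableSet_Ioi
  have hgl : LocallyIntegrableOn (fun x => u x - f x) (Ioi 0) volume :=
    (locallyIntegrableOn_L2 u).sub hfl
  have hint : ∀ ψ : ℝ → ℝ, Continuous ψ → HasCompactSupport ψ → tsupport ψ ⊆ Ioi 0 →
      ∀ g : ℝ → 𝕜, LocallyIntegrableOn g (Ioi 0) volume → Integrable (fun x => ψ x • g x) := by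
    intro ψ hψ hψc hψs g hg
    have hK : IntegrableOn g (tsupport ψ) := hg.integrableOn_compact_subset hψs hψc
    have h2 : IntegrableOn (fun x => ψ x • g x) (tsupport ψ) :=
      hK.continuousOn_smul hψ.continuousOn hψc
    refine (integrableOn_iff_integrable_of_support_subset fun x hx => ?_).mp h2
    by_contra h
    exact hx (by simp [image_eq_zero_of_notMem_tsupport h])
  -- integrals against test functions only see the half-line
  have hset : ∀ ψ : ℝ → ℝ, tsupport ψ ⊆ Ioi 0 → ∀ g : ℝ → 𝕜,
      ∫ x in Ioi (0 : ℝ), ψ x • g x = ∫ x, ψ x • g x := by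
    intro ψ hψ g
    refine setIntegral_eq_integral_of_forall_compl_eq_zero fun x hx => ?_
    rw [image_eq_zero_of_notMem_tsupport fun h => hx (hψ h), zero_smul]
  -- `u - f` has vanishing weak derivative
  have hg0 : ∀ φ : ℝ → ℝ, ContDiff ℝ ∞ φ → HasCompactSupport φ → tsupport φ ⊆ Ioi 0 →
      ∫ x, deriv φ x • (u x - f x) = 0 := by
    intro φ hφ hc hs
    have hs' : tsupport (deriv φ) ⊆ Ioi 0 := (tsupport_deriv_subset (𝕜 := ℝ)).trans hs
    have hdc : Continuous (deriv φ) := hφ.continuous_deriv (by simp)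
    obtain ⟨R, hR⟩ : ∃ R : ℝ, ∀ x ∈ tsupport φ, x ≤ R :=
      (show IsCompact (tsupport φ) from hc).bddAbove
    let V : ℝ → 𝕜 := (Ioc 0 R).indicator v
    have hVi : Integrable V := (integrable_indicator_iff measurableSet_Ioc).mpr (hvI R)
    have h1 := integral_deriv_smul_primitive hVi hφ hc
    have h2 : ∫ x, deriv φ x • ∫ y in Iio x, V y = ∫ x, deriv φ x • f x := by
      refine integral_congr_ae (ae_of_all _ fun x => ?_)
      by_cases hx : x ∈ tsupport φ
      · have hxR := hR x hx
        change deriv φ x • ∫ y in Iio x, V y = deriv φ x • ∫ y in Ioc 0 x, v y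
        congr 1
        rw [← integral_Iic_eq_integral_Iio, ← integral_indicator measurableSet_Iic,
          ← integral_indicator measurableSet_Ioc]
        congr 1
        ext y
        simp only [V, indicator_apply, mem_Iic, mem_Ioc]
        by_cases hy : y ≤ x
        · have : y ≤ R := hy.trans hxR
          simp [hy, this]
        · simp [hy]
      · have : deriv φ x = 0 :=
          image_eq_zero_of_notMem_tsupport fun h => hx (tsupport_deriv_subset (𝕜 := ℝ) h)
        simp [this]
    have h3 : ∫ y, φ y • V y = ∫ y, φ y • v y := by
      refine integral_congr_ae (ae_of_all _ fun y => ?_)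
      by_cases hy : y ∈ tsupport φ
      · have : y ∈ Ioc 0 R := ⟨hs hy, hR y hy⟩
        simp [V, this]
      · simp [image_eq_zero_of_notMem_tsupport hy]
    have h4 := hv φ hφ hc hs
    rw [hset _ hs', hset _ hs] at h4
    simp_rw [smul_sub]
    rw [integral_sub (hint _ hdc hc.deriv hs' _ (locallyIntegrableOn_L2 u))
      (hint _ hdc hc.deriv hs' _ hfl), h4, ← h2, h1, h3, sub_self]
  -- hence it is almost everywhere constant
  let B : ContDiffBump (2 : ℝ) := ⟨1 / 2, 1, by norm_num, by norm_num⟩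
  let ρ : ℝ → ℝ := B.normed volume
  have hρ : ContDiff ℝ ∞ ρ := B.contDiff_normed
  have hρc : HasCompactSupport ρ := B.hasCompactSupport_normed
  have hρs : tsupport ρ ⊆ Ioi 0 := by
    have : tsupport ρ = Metric.closedBall 2 1 := B.tsupport_normed_eq
    rw [this, Real.closedBall_eq_Icc]
    intro x hx
    have := hx.1
    simp only [mem_Ioi]
    linarith
  have hρ1 : ∫ x, ρ x = 1 := B.integral_normed
  let c : 𝕜 := ∫ x, ρ x • (u x - f x)
  have hcl : LocallyIntegrableOn (fun _ : ℝ => c) (Ioi 0) volume :=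
    continuousOn_const.locallyIntegrableOn measurableSet_Ioi
  have key : ∀ᵐ x ∂(volume : Measure ℝ), x ∈ Ioi (0 : ℝ) → (u x - f x) - c = 0 := by
    refine isOpen_Ioi.ae_eq_zero_of_integral_contDiff_smul_eq_zero (hgl.sub hcl)
      fun ψ hψ hψc hψs => ?_
    set m : ℝ := ∫ x, ψ x with hm
    have hmc : HasCompactSupport fun x => m * ρ x := hρc.mul_left
    have hms : tsupport (fun x => m * ρ x) ⊆ Ioi 0 :=
      (tsupport_mul_subset_right (f := fun _ => m) (g := ρ)).trans hρs
    obtain ⟨φ, hφ, hφc, hφs, hφd⟩ := exists_primitive (ψ := fun x => ψ x - m * ρ x)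
      (hψ.sub (contDiff_const.mul hρ)) (hψc.sub hmc)
      ((tsupport_sub ψ (fun x => m * ρ x)).trans (union_subset hψs hms)) (by
        have hmi : Integrable fun x => m * ρ x :=
          (continuous_const.mul hρ.continuous).integrable_of_hasCompactSupport hmc
        rw [integral_sub (hψ.continuous.integrable_of_hasCompactSupport hψc) hmi,
          integral_const_mul, hρ1, mul_one, ← hm, sub_self])
    have h1 := hg0 φ hφ hφc hφs
    rw [hφd] at h1
    have hi1 := hint ψ hψ.continuous hψc hψs _ hgl
    have hi2 := hint ρ hρ.continuous hρc hρs _ hgl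
    have h2 : ∫ x, (ψ x - m * ρ x) • (u x - f x) = (∫ x, ψ x • (u x - f x)) - m • c := by
      have : (fun x => (ψ x - m * ρ x) • (u x - f x))
          = fun x => ψ x • (u x - f x) - m • (ρ x • (u x - f x)) := by
        funext x
        rw [sub_smul, mul_smul]
      have hi3 : Integrable fun x => m • (ρ x • (u x - f x)) := hi2.smul m
      rw [this, integral_sub hi1 hi3, integral_smul]
    have h3 : ∫ x, ψ x • ((u x - f x) - c) = (∫ x, ψ x • (u x - f x)) - m • c := by
      simp_rw [smul_sub _ (_ - _) c]
      rw [integral_sub hi1 (hint ψ hψ.continuous hψc hψs _ hcl), integral_smul_const]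
    change ∫ x, ψ x • ((u x - f x) - c) = 0
    rw [h3, ← h2, h1]
  refine ⟨_, fun x => f x + c, hfc.add continuousOn_const, ?_, rfl⟩
  rw [ae_restrict_iff' measurableSet_Ioi]
  filter_upwards [key] with x hx hx0
  have := hx hx0
  rw [sub_sub, sub_eq_zero] at this
  exact this

lemma hasTrace_trace {u : L2 𝕜} (hu : u ∈ H1 𝕜) : HasTrace u (trace u) := by
  obtain ⟨a, ha⟩ := exists_hasTrace hu
  rwa [ha.trace_eq]

lemma trace_add {u v : L2 𝕜} (hu : u ∈ H1 𝕜) (hv : v ∈ H1 𝕜) :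
    trace (u + v) = trace u + trace v :=
  ((hasTrace_trace hu).add (hasTrace_trace hv)).trace_eq

lemma trace_smul {u : L2 𝕜} (c : 𝕜) (hu : u ∈ H1 𝕜) : trace (c • u) = c * trace u :=
  ((hasTrace_trace hu).smul c).trace_eq

/-! ## The Robin reaction-diffusion-transport operator -/

/-- The domain `{u ∈ H²(ℝ₊) : u'(0) + κ u(0) = 0}`. -/
def robinDomain (𝕜 : Type*) [RCLike 𝕜] (κ : ℝ) : Submodule 𝕜 (L2 𝕜) where
  carrier := {u | u ∈ H2 𝕜 ∧ trace (weakDeriv u) + (κ : 𝕜) * trace u = 0}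
  zero_mem' := by
    refine ⟨zero_mem _, ?_⟩
    rw [isWeakDeriv_zero.weakDeriv_eq, hasTrace_zero.trace_eq]
    simp
  add_mem' := by
    rintro a b ⟨ha, ha0⟩ ⟨hb, hb0⟩
    refine ⟨add_mem ha hb, ?_⟩
    rw [weakDeriv_add ha.1 hb.1, trace_add ha.2 hb.2, trace_add ha.1 hb.1]
    linear_combination ha0 + hb0
  smul_mem' := by
    rintro c a ⟨ha, ha0⟩
    refine ⟨Submodule.smul_mem _ c ha, ?_⟩
    rw [weakDeriv_smul c ha.1, trace_smul c ha.2, trace_smul c ha.1]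
    linear_combination c * ha0

/-- The operator `A_R u = α u'' + β u' + γ u` with domain `{u ∈ H²(ℝ₊) : u'(0) + κ u(0) = 0}`,
as an unbounded operator in `L²(ℝ₊)`. -/
def robinOperator (𝕜 : Type*) [RCLike 𝕜] (α β γ κ : ℝ) : L2 𝕜 →ₗ.[𝕜] L2 𝕜 where
  domain := robinDomain 𝕜 κ
  toFun :=
    { toFun := fun u => (α : 𝕜) • weakDeriv (weakDeriv (u : L2 𝕜))
        + (β : 𝕜) • weakDeriv (u : L2 𝕜) + (γ : 𝕜) • (u : L2 𝕜)
      map_add' := by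
        intro a b
        rw [Submodule.coe_add, weakDeriv_add a.2.1.1 b.2.1.1, weakDeriv_add a.2.1.2 b.2.1.2]
        simp only [smul_add]
        abel
      map_smul' := by
        intro c a
        rw [Submodule.coe_smul, weakDeriv_smul c a.2.1.1, weakDeriv_smul c a.2.1.2]
        simp only [smul_add, smul_comm c, RingHom.id_apply] }

end HalfLine

end

/-!
The proof verifies the hypotheses of the Hille–Yosida theorem for the Robin operator `A`.

*Generation.* `generatesC0Semigroup_of_quasiDissipative` produces a `C₀`-semigroup from a closed,
densely defined operator `A` with `(l - w) ‖u‖ ≤ ‖l u - A u‖` for all `l > w`, such that `l - A` has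
dense range for large `l`. After replacing `A` by `A - w` (which multiplies the semigroup by
`exp (-wt)`) the resolvents `(l - A)⁻¹` have norm at most `1 / l`, and the Yosida approximations
`l (l (l - A)⁻¹ - 1)` are bounded, commute, generate contraction semigroups and converge to `A` on
its domain. Their exponentials therefore converge to a contraction semigroup
(`exists_isC0Semigroup_of_tendsto_generators`), whose generator extends `A`; as `l - A` is onto and
`l` is no eigenvalue of the generator, the two coincide.

*Energy estimate.* Elements of `H¹(ℝ₊)` are primitives of their weak derivatives, which gives
integration by parts with boundary terms (`IsWeakDeriv.re_inner_add_re_inner`). With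
`u'(0) = -κ u(0)` it yields `re ⟨Au, u⟩ = (ακ - β/2) |u(0)|² - α ‖u'‖² + γ ‖u‖²`, and
`|u(0)|² ≤ 2 ‖u'‖ ‖u‖` turns this into `re ⟨Au, u⟩ + (α/2) ‖u'‖² ≤ w ‖u‖²`. So `A` is
quasi-dissipative, and `u'` is controlled by `u` and `Au`; closedness follows, since weak
differentiation is closed and the trace is continuous on `H¹(ℝ₊)`.

*Density.* Test functions lie in the domain, and they also lie in the range of `l - A` for large
`l`: there `α r² + β r + (γ - l)` has real roots `r₁` and `r₂ < 0`, and `(l - A) u = φ` is solved by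
solving two first-order linear equations. The solution is a multiple of `exp (r₂ x)` beyond the
support of `φ`, hence square-integrable, and its free constant adjusts the boundary condition
because `r₂ ≠ -κ`.
-/

noncomputable section

/-! ### Exponentials of bounded operators -/

section Exponential

variable {𝕜 X : Type*} [RCLike 𝕜] [NormedAddCommGroup X] [NormedSpace 𝕜 X] [CompleteSpace X]

lemma hasDerivAt_exp_ofReal_smul_apply [NormedSpace ℝ X] [IsScalarTower ℝ 𝕜 X]
    (C : X →L[𝕜] X) (x : X) (s : ℝ) :
    HasDerivAt (fun s : ℝ => NormedSpace.exp ((s : 𝕜) • C) x)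
      (NormedSpace.exp ((s : 𝕜) • C) (C x)) s := by
  have h1 := (hasDerivAt_exp_smul_const C (s : 𝕜)).clm_apply (hasDerivAt_const (s : 𝕜) x)
  simp only [map_zero, add_zero] at h1
  have h2 : HasDerivAt (fun s : ℝ => (s : 𝕜)) 1 s := by
    simpa using (RCLike.ofRealCLM (K := 𝕜)).hasDerivAt (x := s)
  have h3 := HasDerivAt.scomp s h1 h2
  rw [one_smul] at h3
  exact h3

/-- Two commuting bounded generators of contraction semigroups: interpolating along
`s ↦ exp (sP) exp ((t - s)Q) x` shows that the semigroups differ by at most `t ‖Px - Qx‖`. -/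
lemma norm_exp_apply_sub_exp_apply_le {P Q : X →L[𝕜] X} (hPQ : Commute P Q)
    (hP : ∀ s : ℝ, 0 ≤ s → ‖NormedSpace.exp ((s : 𝕜) • P)‖ ≤ 1)
    (hQ : ∀ s : ℝ, 0 ≤ s → ‖NormedSpace.exp ((s : 𝕜) • Q)‖ ≤ 1) {t : ℝ} (ht : 0 ≤ t) (x : X) :
    ‖NormedSpace.exp ((t : 𝕜) • P) x - NormedSpace.exp ((t : 𝕜) • Q) x‖ ≤ t * ‖P x - Q x‖ := by
  let _ : NormedSpace ℝ X := NormedSpace.restrictScalars ℝ 𝕜 X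
  have : IsScalarTower ℝ 𝕜 X := RestrictScalars.isScalarTower ℝ 𝕜 X
  let _ : NormedAlgebra ℚ (X →L[𝕜] X) := .restrictScalars ℚ 𝕜 _
  have hsplit : ∀ s : ℝ, NormedSpace.exp ((s : 𝕜) • (P - Q)) * NormedSpace.exp ((t : 𝕜) • Q)
      = NormedSpace.exp ((s : 𝕜) • P) * NormedSpace.exp (((t - s : ℝ) : 𝕜) • Q) := by
    intro s
    rw [← NormedSpace.exp_add_of_commute, ← NormedSpace.exp_add_of_commute]
    · congr 1
      push_cast
      module
    · exact (hPQ.smul_left _).smul_right _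
    · exact ((hPQ.sub_left (Commute.refl Q)).smul_left _).smul_right _
  have hcomm : Commute (NormedSpace.exp ((t : 𝕜) • Q)) (P - Q) :=
    (((hPQ.sub_left (Commute.refl Q)).symm.smul_left (t : 𝕜))).exp_left
  have hd : ∀ s ∈ Icc 0 t, HasDerivWithinAt
      (fun s : ℝ => NormedSpace.exp ((s : 𝕜) • (P - Q)) (NormedSpace.exp ((t : 𝕜) • Q) x))
      (NormedSpace.exp ((s : 𝕜) • (P - Q)) ((P - Q) (NormedSpace.exp ((t : 𝕜) • Q) x)))
      (Icc 0 t) s := fun s _ =>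
    (hasDerivAt_exp_ofReal_smul_apply (P - Q) _ s).hasDerivWithinAt
  have hb : ∀ s ∈ Ico 0 t, ‖NormedSpace.exp ((s : 𝕜) • (P - Q))
      ((P - Q) (NormedSpace.exp ((t : 𝕜) • Q) x))‖ ≤ ‖P x - Q x‖ := by
    intro s hs
    have h1 : NormedSpace.exp ((s : 𝕜) • (P - Q)) ((P - Q) (NormedSpace.exp ((t : 𝕜) • Q) x))
        = NormedSpace.exp ((s : 𝕜) • P)
          (NormedSpace.exp (((t - s : ℝ) : 𝕜) • Q) (P x - Q x)) := by
      have h2 := congrArg (fun F : X →L[𝕜] X => F ((P - Q) x)) (hsplit s)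
      have h3 := congrArg (fun F : X →L[𝕜] X => F x) hcomm.eq
      simp only [mul_apply_eq_comp] at h2 h3
      rw [← h3, h2]
      rfl
    rw [h1]
    calc _ ≤ ‖NormedSpace.exp (((t - s : ℝ) : 𝕜) • Q) (P x - Q x)‖ :=
          ContinuousLinearMap.le_of_opNorm_le_of_le _ (hP s hs.1) le_rfl |>.trans (by simp)
      _ ≤ ‖P x - Q x‖ :=
          ContinuousLinearMap.le_of_opNorm_le_of_le _ (hQ _ (by linarith [hs.2])) le_rfl
            |>.trans (by simp)
  have h := norm_image_sub_le_of_norm_deriv_le_segment' hd hb t ⟨ht, le_rfl⟩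
  have e1 := congrArg (fun F : X →L[𝕜] X => F x) (hsplit t)
  have e0 : NormedSpace.exp (((0 : ℝ) : 𝕜) • (P - Q)) = 1 := by simp
  simp only [mul_apply_eq_comp, sub_self, RCLike.ofReal_zero, zero_smul,
    NormedSpace.exp_zero, one_apply_eq_self] at e1
  rw [e1, e0, one_apply_eq_self, sub_zero, mul_comm] at h
  exact h

lemma norm_exp_apply_sub_le {C : X →L[𝕜] X}
    (hC : ∀ s : ℝ, 0 ≤ s → ‖NormedSpace.exp ((s : 𝕜) • C)‖ ≤ 1) {t : ℝ} (ht : 0 ≤ t) (x : X) :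
    ‖NormedSpace.exp ((t : 𝕜) • C) x - x‖ ≤ t * ‖C x‖ := by
  have h := norm_exp_apply_sub_exp_apply_le (Commute.zero_right C) hC (fun s _ => by
    rw [smul_zero, NormedSpace.exp_zero]
    exact ContinuousLinearMap.norm_id_le) ht x
  simpa using h

/-- First-order expansion of a contraction semigroup with bounded generator `C` at `x`, with `y`
in place of `C x`; the error is controlled by how little the semigroup moves `y`. -/
lemma norm_exp_apply_sub_sub_smul_le {C : X →L[𝕜] X}
    (hC : ∀ s : ℝ, 0 ≤ s → ‖NormedSpace.exp ((s : 𝕜) • C)‖ ≤ 1) {t : ℝ} (ht : 0 ≤ t) (x y : X)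
    {K : ℝ} (hK : ∀ s ∈ Ico 0 t, ‖NormedSpace.exp ((s : 𝕜) • C) y - y‖ ≤ K) :
    ‖NormedSpace.exp ((t : 𝕜) • C) x - x - (t : 𝕜) • y‖ ≤ t * (‖C x - y‖ + K) := by
  let _ : NormedSpace ℝ X := NormedSpace.restrictScalars ℝ 𝕜 X
  have : IsScalarTower ℝ 𝕜 X := RestrictScalars.isScalarTower ℝ 𝕜 X
  have hd : ∀ s ∈ Icc 0 t, HasDerivWithinAt
      (fun s : ℝ => NormedSpace.exp ((s : 𝕜) • C) x - s • y)
      (NormedSpace.exp ((s : 𝕜) • C) (C x) - y) (Icc 0 t) s := by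
    intro s _
    have h1 := (hasDerivAt_exp_ofReal_smul_apply C x s).sub ((hasDerivAt_id s).smul_const y)
    rw [one_smul] at h1
    exact h1.hasDerivWithinAt
  have hb : ∀ s ∈ Ico 0 t, ‖NormedSpace.exp ((s : 𝕜) • C) (C x) - y‖ ≤ ‖C x - y‖ + K := by
    intro s hs
    have h1 : NormedSpace.exp ((s : 𝕜) • C) (C x) - y
        = NormedSpace.exp ((s : 𝕜) • C) (C x - y) + (NormedSpace.exp ((s : 𝕜) • C) y - y) := by
      rw [map_sub]
      abel
    rw [h1]
    refine (norm_add_le _ _).trans (add_le_add ?_ (hK s hs))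
    exact (ContinuousLinearMap.le_of_opNorm_le_of_le _ (hC s hs.1) le_rfl).trans (by simp)
  have h := norm_image_sub_le_of_norm_deriv_le_segment' hd hb t ⟨ht, le_rfl⟩
  have e : NormedSpace.exp (((0 : ℝ) : 𝕜) • C) = 1 := by simp
  rw [e, one_apply_eq_self, zero_smul, sub_zero, sub_zero, mul_comm] at h
  have e2 : (t : 𝕜) • y = t • y := by
    rw [← RCLike.real_smul_eq_coe_smul]
  rw [e2]
  refine le_trans (le_of_eq ?_) h
  congr 1
  abel

/-- Exponentiating `c (J - 1)` with `J` a contraction and `c ≥ 0` gives a contraction: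
`exp (c (J - 1)) = exp (-c) ∑ cⁿ Jⁿ / n!`. -/
lemma norm_exp_smul_sub_one_le {J : X →L[𝕜] X} (hJ : ‖J‖ ≤ 1) {c : ℝ} (hc : 0 ≤ c) :
    ‖NormedSpace.exp ((c : 𝕜) • (J - 1))‖ ≤ 1 := by
  let _ : NormedAlgebra ℚ (X →L[𝕜] X) := .restrictScalars ℚ 𝕜 _
  have hpow : ∀ n : ℕ, ‖J ^ n‖ ≤ 1 := by
    intro n
    induction n with
    | zero => exact ContinuousLinearMap.norm_id_le
    | succ k ih =>
      rw [pow_succ]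
      exact (norm_mul_le _ _).trans (mul_le_one₀ ih (norm_nonneg _) hJ)
  have h1 : ‖NormedSpace.exp ((c : 𝕜) • J)‖ ≤ Real.exp c := by
    have hs := NormedSpace.exp_series_hasSum_exp' (𝕂 := 𝕜) ((c : 𝕜) • J)
    have hr : HasSum (fun n : ℕ => ((n.factorial : ℝ))⁻¹ • c ^ n) (NormedSpace.exp c) :=
      NormedSpace.exp_series_hasSum_exp' (𝕂 := ℝ) c
    rw [← Real.exp_eq_exp_ℝ] at hr
    rw [← hs.tsum_eq]
    refine tsum_of_norm_bounded hr fun n => ?_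
    rw [smul_pow, norm_smul, norm_smul, norm_inv, norm_pow, RCLike.norm_natCast,
      RCLike.norm_ofReal, abs_of_nonneg hc, smul_eq_mul]
    exact mul_le_mul_of_nonneg_left (mul_le_of_le_one_right (by positivity) (hpow n))
      (by positivity)
  have h2 : NormedSpace.exp ((c : 𝕜) • (J - 1))
      = ((Real.exp (-c) : ℝ) : 𝕜) • NormedSpace.exp ((c : 𝕜) • J) := by
    have e : (c : 𝕜) • (J - 1) = algebraMap 𝕜 (X →L[𝕜] X) ((-c : ℝ) : 𝕜) + (c : 𝕜) • J := by
      rw [Algebra.algebraMap_eq_smul_one]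
      push_cast
      module
    rw [e, NormedSpace.exp_add_of_commute (Algebra.commutes _ _),
      ← NormedSpace.algebraMap_exp_comm, ← Algebra.smul_def]
    congr 1
    rw [Real.exp_eq_exp_ℝ]
    exact (NormedSpace.algebraMap_exp_comm (𝕂 := ℝ) (𝔸 := 𝕜) (-c)).symm
  rw [h2, norm_smul, RCLike.norm_ofReal, abs_of_pos (Real.exp_pos _)]
  calc Real.exp (-c) * ‖NormedSpace.exp ((c : 𝕜) • J)‖ ≤ Real.exp (-c) * Real.exp c :=
        mul_le_mul_of_nonneg_left h1 (Real.exp_pos _).le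
    _ = 1 := by rw [← Real.exp_add]; simp

end Exponential

/-! ### Limits of uniformly continuous contraction semigroups -/

section Limit

variable {𝕜 X : Type*} [RCLike 𝕜] [NormedAddCommGroup X] [NormedSpace 𝕜 X]

lemma ContinuousLinearMap.norm_apply_le_of_norm_le_one {S : X →L[𝕜] X} (hS : ‖S‖ ≤ 1) (x : X) :
    ‖S x‖ ≤ ‖x‖ := by
  simpa using S.le_of_opNorm_le hS x

lemma cauchySeq_apply_of_dense [CompleteSpace X] {S : ℕ → X →L[𝕜] X} (hS : ∀ n, ‖S n‖ ≤ 1)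
    {D : Set X} (hD : Dense D) (h : ∀ x ∈ D, CauchySeq fun n => S n x) (x : X) :
    CauchySeq fun n => S n x := by
  rw [Metric.cauchySeq_iff']
  intro ε hε
  obtain ⟨y, hy, hxy⟩ := hD.exists_dist_lt x (ε := ε / 3) (by positivity)
  obtain ⟨N, hN⟩ := Metric.cauchySeq_iff'.mp (h y hy) (ε / 3) (by positivity)
  refine ⟨N, fun n hn => ?_⟩
  have h1 : ∀ k, dist (S k x) (S k y) < ε / 3 := fun k => by
    rw [dist_eq_norm, ← map_sub]
    refine lt_of_le_of_lt ((S k).norm_apply_le_of_norm_le_one (hS k) _) ?_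
    rwa [← dist_eq_norm]
  calc dist (S n x) (S N x) ≤ dist (S n x) (S n y) + dist (S n y) (S N y) + dist (S N y) (S N x) :=
        dist_triangle4 _ _ _ _
    _ < ε / 3 + ε / 3 + ε / 3 := by
        have := h1 N
        rw [dist_comm] at this
        exact add_lt_add (add_lt_add (h1 n) (hN n hn)) this
    _ = ε := by ring

/-- A contraction semigroup that is continuous at `0` along the orbits of a dense set is strongly
continuous. -/
lemma isC0Semigroup_of_norm_le_one {S : ℝ≥0 → X →L[𝕜] X} (h0 : S 0 = ContinuousLinearMap.id 𝕜 X)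
    (hadd : ∀ s t : ℝ≥0, S (t + s) = (S t).comp (S s)) (hS : ∀ t, ‖S t‖ ≤ 1) {D : Set X}
    (hD : Dense D) (hc : ∀ x ∈ D, ∃ K : ℝ, ∀ t : ℝ≥0, ‖S t x - x‖ ≤ t * K) : IsC0Semigroup S := by
  refine ⟨h0, hadd, fun x => ?_⟩
  have hdist : ∀ s t : ℝ≥0, ∀ y, s ≤ t → dist (S t y) (S s y) ≤ ‖S (t - s) y - y‖ := by
    intro s t y hst
    have h1 : S t = (S s).comp (S (t - s)) := by rw [← hadd, add_tsub_cancel_of_le hst]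
    rw [h1, ContinuousLinearMap.comp_apply, dist_eq_norm, ← map_sub]
    exact (S s).norm_apply_le_of_norm_le_one (hS s) _
  have hsym : ∀ y K, (∀ t : ℝ≥0, ‖S t y - y‖ ≤ t * K) → ∀ s t : ℝ≥0,
      dist (S t y) (S s y) ≤ dist t s * K := by
    intro y K hK s t
    rcases le_total s t with hst | hst
    · refine (hdist s t y hst).trans ((hK _).trans (le_of_eq ?_))
      rw [NNReal.dist_eq, NNReal.coe_sub hst, abs_of_nonneg (sub_nonneg.mpr (by exact_mod_cast hst))]
    · rw [dist_comm, dist_comm t s]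
      refine (hdist t s y hst).trans ((hK _).trans (le_of_eq ?_))
      rw [NNReal.dist_eq, NNReal.coe_sub hst, abs_of_nonneg (sub_nonneg.mpr (by exact_mod_cast hst))]
  have hcD : ∀ y ∈ D, Continuous fun t => S t y := by
    intro y hy
    obtain ⟨K, hK⟩ := hc y hy
    rw [continuous_iff_continuousAt]
    intro s
    rw [ContinuousAt, tendsto_iff_dist_tendsto_zero]
    refine squeeze_zero (fun _ => dist_nonneg) (hsym y K hK s) ?_
    have : Tendsto (fun t : ℝ≥0 => dist t s * K) (𝓝 s) (𝓝 (dist s s * K)) :=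
      (Continuous.tendsto (by fun_prop) s)
    simpa using this
  rw [Metric.continuous_iff]
  intro s ε hε
  obtain ⟨y, hy, hxy⟩ := hD.exists_dist_lt x (ε := ε / 3) (by positivity)
  obtain ⟨δ, hδ, hδ'⟩ := Metric.continuous_iff.mp (hcD y hy) s (ε / 3) (by positivity)
  refine ⟨δ, hδ, fun t ht => ?_⟩
  have h1 : ∀ t, dist (S t x) (S t y) < ε / 3 := fun k => by
    rw [dist_eq_norm, ← map_sub]
    refine lt_of_le_of_lt ((S k).norm_apply_le_of_norm_le_one (hS k) _) ?_
    rwa [← dist_eq_norm]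
  calc dist (S t x) (S s x) ≤ dist (S t x) (S t y) + dist (S t y) (S s y) + dist (S s y) (S s x) :=
        dist_triangle4 _ _ _ _
    _ < ε / 3 + ε / 3 + ε / 3 := by
        have := h1 s
        rw [dist_comm] at this
        exact add_lt_add (add_lt_add (h1 t) (hδ' t ht)) this
    _ = ε := by ring

/-- `y` is the generator value at `x` as soon as `S t x - x - t y` is bounded by `t` times a
quantity that can be made small. -/
lemma hasGeneratorValue_of_forall_norm_le {S : ℝ≥0 → X →L[𝕜] X} {x y : X}
    (h : ∀ ε > 0, ∃ K : ℝ, ∀ t : ℝ≥0, ‖S t x - x - ((t : ℝ) : 𝕜) • y‖ ≤ t * (ε + t * K)) :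
    HasGeneratorValue S x y := by
  rw [HasGeneratorValue, Metric.tendsto_nhds]
  intro ε hε
  obtain ⟨K, hK⟩ := h (ε / 2) (by positivity)
  have hlim : Tendsto (fun t : ℝ≥0 => ε / 2 + (t : ℝ) * K) (𝓝[>] 0) (𝓝 (ε / 2)) := by
    have : Tendsto (fun t : ℝ≥0 => ε / 2 + (t : ℝ) * K) (𝓝 0) (𝓝 (ε / 2 + ((0 : ℝ≥0) : ℝ) * K)) :=
      (Continuous.tendsto (by fun_prop) 0)
    rw [NNReal.coe_zero, zero_mul, add_zero] at this
    exact this.mono_left nhdsWithin_le_nhds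
  filter_upwards [hlim.eventually (gt_mem_nhds (half_lt_self hε)), self_mem_nhdsWithin] with t ht ht0
  have ht0' : (0 : ℝ) < t := by exact_mod_cast (show (0 : ℝ≥0) < t from ht0)
  have hne : ((t : ℝ) : 𝕜) ≠ 0 := by exact_mod_cast ht0'.ne'
  have e : ((t : ℝ) : 𝕜)⁻¹ • (S t x - x) - y
      = ((t : ℝ) : 𝕜)⁻¹ • (S t x - x - ((t : ℝ) : 𝕜) • y) := by
    rw [smul_sub _ (S t x - x), inv_smul_smul₀ hne]
  rw [dist_eq_norm, e, norm_smul, norm_inv, RCLike.norm_ofReal, abs_of_pos ht0']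
  refine lt_of_le_of_lt ?_ ht
  rw [inv_mul_le_iff₀ ht0']
  exact hK t

/-- If commuting bounded generators `B n` of contraction semigroups converge pointwise to `L` on a
dense set, their semigroups converge strongly to a `C₀`-semigroup of contractions whose generator
extends `L`. -/
theorem exists_isC0Semigroup_of_tendsto_generators [CompleteSpace X] {B : ℕ → X →L[𝕜] X}
    (hcomm : ∀ m n, Commute (B m) (B n))
    (hexp : ∀ n, ∀ s : ℝ, 0 ≤ s → ‖NormedSpace.exp ((s : 𝕜) • B n)‖ ≤ 1) {D : Set X}
    (hD : Dense D) {L : X → X} (hL : ∀ x ∈ D, Tendsto (fun n => B n x) atTop (𝓝 (L x))) :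
    ∃ S : ℝ≥0 → X →L[𝕜] X, IsC0Semigroup S ∧ (∀ t, ‖S t‖ ≤ 1) ∧
      ∀ x ∈ D, HasGeneratorValue S x (L x) := by
  let _ : NormedAlgebra ℚ (X →L[𝕜] X) := .restrictScalars ℚ 𝕜 _
  set E : ℕ → ℝ≥0 → X →L[𝕜] X := fun n t => NormedSpace.exp (((t : ℝ) : 𝕜) • B n) with hE
  have hE1 : ∀ n t, ‖E n t‖ ≤ 1 := fun n t => hexp n t t.2
  have hcauchy : ∀ t x, CauchySeq fun n => E n t x := by
    intro t
    refine cauchySeq_apply_of_dense (fun n => hE1 n t) hD fun x hx => ?_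
    have hB := (hL x hx).cauchySeq
    rw [Metric.cauchySeq_iff] at hB ⊢
    intro ε hε
    obtain ⟨N, hN⟩ := hB (ε / (t + 1)) (by positivity)
    refine ⟨N, fun m hm n hn => ?_⟩
    rw [dist_eq_norm]
    refine lt_of_le_of_lt (norm_exp_apply_sub_exp_apply_le (hcomm m n) (hexp m) (hexp n) t.2 x) ?_
    have h1 := hN m hm n hn
    rw [dist_eq_norm, lt_div_iff₀ (by positivity)] at h1
    change (t : ℝ) * _ < ε
    nlinarith [norm_nonneg (B m x - B n x)]
  choose F hF using fun t x => cauchySeq_tendsto_of_complete (hcauchy t x)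
  let S : ℝ≥0 → X →L[𝕜] X := fun t => LinearMap.mkContinuous
    (linearMapOfTendsto (F t) (fun n => (E n t : X →ₗ[𝕜] X)) (tendsto_pi_nhds.mpr (hF t))) 1
    fun x => by
      rw [one_mul]
      exact le_of_tendsto (hF t x).norm
        (Eventually.of_forall fun n => (E n t).norm_apply_le_of_norm_le_one (hE1 n t) x)
  have hS : ∀ t x, Tendsto (fun n => E n t x) atTop (𝓝 (S t x)) := hF
  have hS1 : ∀ t, ‖S t‖ ≤ 1 := fun t => LinearMap.mkContinuous_norm_le _ zero_le_one _
  have hS0 : S 0 = ContinuousLinearMap.id 𝕜 X := by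
    ext x
    refine tendsto_nhds_unique (hS 0 x) ?_
    simp [hE]
  have hSadd : ∀ s t : ℝ≥0, S (t + s) = (S t).comp (S s) := by
    intro s t
    ext x
    refine tendsto_nhds_unique (hS (t + s) x) ?_
    have h1 : ∀ n, E n (t + s) x = E n t (E n s x - S s x) + E n t (S s x) := by
      intro n
      rw [← map_add, sub_add_cancel]
      simp only [hE]
      rw [NNReal.coe_add, RCLike.ofReal_add, add_smul, NormedSpace.exp_add_of_commute]
      · rfl
      · exact ((Commute.refl (B n)).smul_left _).smul_right _
    simp_rw [h1]
    have h2 : Tendsto (fun n => E n t (E n s x - S s x)) atTop (𝓝 0) := by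
      have h3 := tendsto_iff_norm_sub_tendsto_zero.mp (hS s x)
      exact squeeze_zero_norm (fun n => (E n t).norm_apply_le_of_norm_le_one (hE1 n t) _) h3
    simpa using h2.add (hS t (S s x))
  have hsmall : ∀ x ∈ D, ∀ t : ℝ≥0, ‖S t x - x‖ ≤ t * ‖L x‖ := by
    intro x hx t
    exact le_of_tendsto_of_tendsto' ((hS t x).sub_const x).norm ((hL x hx).norm.const_mul (t : ℝ))
      fun n => norm_exp_apply_sub_le (hexp n) t.2 x
  refine ⟨S, isC0Semigroup_of_norm_le_one hS0 hSadd hS1 hD fun x hx => ⟨‖L x‖, hsmall x hx⟩, hS1,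
    fun x hx => hasGeneratorValue_of_forall_norm_le fun ε hε => ?_⟩
  obtain ⟨z, hz, hxz⟩ := hD.exists_dist_lt (L x) (ε := ε / 2) (by positivity)
  rw [dist_eq_norm] at hxz
  refine ⟨‖L z‖, fun t => ?_⟩
  have hmove : ∀ n, ∀ s ∈ Ico (0 : ℝ) t,
      ‖NormedSpace.exp ((s : 𝕜) • B n) (L x) - L x‖ ≤ ε + t * ‖B n z‖ := by
    intro n s hs
    have h1 : NormedSpace.exp ((s : 𝕜) • B n) (L x) - L x
        = NormedSpace.exp ((s : 𝕜) • B n) (L x - z) - (L x - z)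
          + (NormedSpace.exp ((s : 𝕜) • B n) z - z) := by
      rw [map_sub]
      abel
    have h2 := ContinuousLinearMap.norm_apply_le_of_norm_le_one (hexp n s hs.1) (L x - z)
    have h3 := norm_exp_apply_sub_le (hexp n) hs.1 z
    have h4 : s * ‖B n z‖ ≤ t * ‖B n z‖ := mul_le_mul_of_nonneg_right hs.2.le (norm_nonneg _)
    rw [h1]
    have h5 := norm_add_le (NormedSpace.exp ((s : 𝕜) • B n) (L x - z) - (L x - z))
      (NormedSpace.exp ((s : 𝕜) • B n) z - z)
    have h6 := norm_sub_le (NormedSpace.exp ((s : 𝕜) • B n) (L x - z)) (L x - z)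
    linarith
  have hlhs : Tendsto (fun n => ‖E n t x - x - ((t : ℝ) : 𝕜) • L x‖) atTop
      (𝓝 ‖S t x - x - ((t : ℝ) : 𝕜) • L x‖) :=
    (((hS t x).sub_const x).sub_const _).norm
  have hrhs : Tendsto (fun n => (t : ℝ) * (‖B n x - L x‖ + (ε + t * ‖B n z‖))) atTop
      (𝓝 ((t : ℝ) * (0 + (ε + t * ‖L z‖)))) :=
    ((tendsto_iff_norm_sub_tendsto_zero.mp (hL x hx)).add
      (((hL z hz).norm.const_mul (t : ℝ)).const_add ε)).const_mul (t : ℝ)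
  rw [zero_add] at hrhs
  exact le_of_tendsto_of_tendsto' hlhs hrhs
    fun n => norm_exp_apply_sub_sub_smul_le (hexp n) t.2 x (L x) (hmove n)

end Limit

/-! ### The Hille–Yosida generation theorem for quasi-dissipative operators -/

section HilleYosida

variable {𝕜 X : Type*} [RCLike 𝕜] [NormedAddCommGroup X] [NormedSpace 𝕜 X]

lemma mem_graph_semigroupGenerator {T : ℝ≥0 → X →L[𝕜] X} {x y : X} :
    (x, y) ∈ (semigroupGenerator T).graph ↔ HasGeneratorValue T x y := by
  rw [LinearPMap.mem_graph_iff]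
  constructor
  · rintro ⟨u, hu, huy⟩
    simp only at hu huy
    rw [← hu, ← huy]
    exact u.2.choose_spec
  · intro h
    refine ⟨⟨x, y, h⟩, rfl, ?_⟩
    exact tendsto_nhds_unique (Exists.choose_spec (⟨y, h⟩ : ∃ y, HasGeneratorValue T x y)) h

lemma HasGeneratorValue.sub {T : ℝ≥0 → X →L[𝕜] X} {x y x' y' : X} (h : HasGeneratorValue T x y)
    (h' : HasGeneratorValue T x' y') : HasGeneratorValue T (x - x') (y - y') := by
  rw [← mem_graph_semigroupGenerator] at *
  exact sub_mem h h'

/-- The generator of a contraction semigroup has no positive eigenvalue. -/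
lemma HasGeneratorValue.eq_zero_of_norm_le_one {S : ℝ≥0 → X →L[𝕜] X} (hS : ∀ t, ‖S t‖ ≤ 1) {l : ℝ}
    (hl : 0 < l) {z : X} (h : HasGeneratorValue S z ((l : 𝕜) • z)) : z = 0 := by
  have h1 : Tendsto (fun t : ℝ≥0 => ‖(((t : ℝ) : 𝕜))⁻¹ • (S t z - z) - (l : 𝕜) • z‖) (𝓝[>] 0)
      (𝓝 0) := tendsto_iff_norm_sub_tendsto_zero.mp h
  have h2 : l * ‖z‖ ≤ 0 := by
    refine ge_of_tendsto h1 ?_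
    filter_upwards [self_mem_nhdsWithin] with t ht
    have ht0 : (0 : ℝ) < t := by exact_mod_cast (show (0 : ℝ≥0) < t from ht)
    have e : (((t : ℝ) : 𝕜))⁻¹ • (S t z - z) - (l : 𝕜) • z
        = (((t : ℝ)⁻¹ : ℝ) : 𝕜) • S t z - (((t : ℝ)⁻¹ + l : ℝ) : 𝕜) • z := by
      push_cast
      module
    rw [e, norm_sub_rev]
    refine le_trans ?_ (norm_sub_norm_le _ _)
    rw [norm_smul, norm_smul, RCLike.norm_ofReal, RCLike.norm_ofReal, abs_of_pos (by positivity),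
      abs_of_pos (by positivity), add_mul]
    have := mul_le_mul_of_nonneg_left ((S t).norm_apply_le_of_norm_le_one (hS t) z)
      (inv_pos.mpr ht0).le
    linarith
  have h3 : ‖z‖ ≤ 0 := by
    by_contra h4
    push Not at h4
    nlinarith
  exact norm_le_zero_iff.mp h3

/-- Multiplying a `C₀`-semigroup by `exp (ct)` adds `c` to its generator. -/
lemma HasGeneratorValue.exp_smul {S : ℝ≥0 → X →L[𝕜] X} (c : ℝ) {x y : X}
    (h : HasGeneratorValue S x y) :
    HasGeneratorValue (fun t : ℝ≥0 => ((Real.exp (c * t) : ℝ) : 𝕜) • S t) x (y + (c : 𝕜) • x) := by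
  have hexp : Tendsto (fun t : ℝ≥0 => ((Real.exp (c * t) : ℝ) : 𝕜)) (𝓝[>] 0) (𝓝 1) := by
    have : Tendsto (fun t : ℝ≥0 => ((Real.exp (c * t) : ℝ) : 𝕜)) (𝓝 0)
        (𝓝 ((Real.exp (c * (0 : ℝ≥0)) : ℝ) : 𝕜)) :=
      Continuous.tendsto (RCLike.continuous_ofReal.comp (by fun_prop)) 0
    simp only [NNReal.coe_zero, mul_zero, Real.exp_zero, RCLike.ofReal_one] at this
    exact this.mono_left nhdsWithin_le_nhds
  have hder : Tendsto (fun t : ℝ≥0 => (((t : ℝ)⁻¹ * (Real.exp (c * t) - 1) : ℝ) : 𝕜)) (𝓝[>] 0)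
      (𝓝 (c : 𝕜)) := by
    have h1 : HasDerivAt (fun t : ℝ => Real.exp (c * t)) c 0 := by
      have := ((hasDerivAt_id (0 : ℝ)).const_mul c).exp
      simpa using this
    have h2 := h1.tendsto_slope_zero_right
    have h3 : Tendsto (fun t : ℝ≥0 => (t : ℝ)) (𝓝[>] 0) (𝓝[>] 0) := by
      refine tendsto_nhdsWithin_iff.mpr ⟨?_, ?_⟩
      · exact (NNReal.continuous_coe.tendsto 0).mono_left nhdsWithin_le_nhds
      · filter_upwards [self_mem_nhdsWithin] with t ht
        exact_mod_cast (show (0 : ℝ≥0) < t from ht)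
    have h4 := (RCLike.continuous_ofReal (K := 𝕜)).tendsto c |>.comp (h2.comp h3)
    refine h4.congr fun t => ?_
    simp
  have := (hexp.smul h).add (hder.smul_const x)
  rw [one_smul] at this
  refine this.congr fun t => ?_
  rw [smul_apply]
  push_cast
  module

lemma IsC0Semigroup.exp_smul {S : ℝ≥0 → X →L[𝕜] X} (hS : IsC0Semigroup S) (c : ℝ) :
    IsC0Semigroup (fun t : ℝ≥0 => ((Real.exp (c * t) : ℝ) : 𝕜) • S t) where
  map_zero := by simp [hS.map_zero]
  map_add s t := by
    ext x
    simp only [hS.map_add, smul_apply, ContinuousLinearMap.comp_apply,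
      map_smul, smul_smul, NNReal.coe_add, mul_add, Real.exp_add, RCLike.ofReal_mul]
    rw [mul_comm]
  continuous_orbit x := by
    have h1 : Continuous fun t : ℝ≥0 => ((Real.exp (c * t) : ℝ) : 𝕜) :=
      RCLike.continuous_ofReal.comp (by fun_prop)
    exact h1.smul (hS.continuous_orbit x)

/-- `l - A` is invertible with inverse of norm at most `1 / l`, if `A` is closed and dissipative
and `l - A` has dense range. -/
lemma exists_resolvent [CompleteSpace X] {A : X →ₗ.[𝕜] X} (hA : A.IsClosed) {l : ℝ} (hl : 0 < l)
    (hdiss : ∀ u : A.domain, l * ‖(u : X)‖ ≤ ‖(l : 𝕜) • (u : X) - A u‖)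
    (hrange : Dense (range fun u : A.domain => (l : 𝕜) • (u : X) - A u)) :
    ∃ R : X →L[𝕜] X, ‖R‖ ≤ l⁻¹ ∧ (∀ u : A.domain, R ((l : 𝕜) • (u : X) - A u) = u) ∧
      ∀ f, ∃ u : A.domain, (l : 𝕜) • (u : X) - A u = f := by
  let M : A.domain →ₗ[𝕜] X := (l : 𝕜) • A.domain.subtype - A.toFun
  have hM : ∀ u, M u = (l : 𝕜) • (u : X) - A u := fun u => rfl
  have hinj : Function.Injective M := by
    rw [injective_iff_map_eq_zero]
    intro u hu
    have h1 := hdiss u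
    rw [← hM, hu, norm_zero] at h1
    have h2 : ‖(u : X)‖ ≤ 0 := by
      by_contra h3
      push Not at h3
      nlinarith
    exact Subtype.ext (norm_le_zero_iff.mp h2)
  have hsurj : Function.Surjective M := by
    intro f
    obtain ⟨g, hg, hgf⟩ := mem_closure_iff_seq_limit.mp (hrange f)
    choose u hu using hg
    have hu' : ∀ n, (l : 𝕜) • (u n : X) - A (u n) = g n := hu
    have hcau : CauchySeq fun n => (u n : X) := by
      have hgc := hgf.cauchySeq
      rw [Metric.cauchySeq_iff] at hgc ⊢
      intro ε hε
      obtain ⟨N, hN⟩ := hgc (l * ε) (by positivity)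
      refine ⟨N, fun m hm n hn => ?_⟩
      have h1 := hdiss (u m - u n)
      have h2 := hN m hm n hn
      rw [← hM, map_sub, hM, hM, hu', hu', ← dist_eq_norm (g m)] at h1
      have h3 := h1.trans_lt h2
      rw [dist_eq_norm]
      exact lt_of_mul_lt_mul_left h3 hl.le
    obtain ⟨x, hx⟩ := cauchySeq_tendsto_of_complete hcau
    have hAu : Tendsto (fun n => A (u n)) atTop (𝓝 ((l : 𝕜) • x - f)) := by
      refine ((hx.const_smul (l : 𝕜)).sub hgf).congr fun n => ?_
      rw [← hu']
      abel
    have hmem : (x, (l : 𝕜) • x - f) ∈ A.graph :=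
      IsClosed.mem_of_tendsto (s := (A.graph : Set (X × X))) hA (hx.prodMk_nhds hAu)
        (Eventually.of_forall fun n => A.mem_graph (u n))
    obtain ⟨v, hv1, hv2⟩ := LinearPMap.mem_graph_iff _ |>.mp hmem
    simp only at hv1 hv2
    exact ⟨v, by rw [hM, hv2, hv1]; abel⟩
  let e := LinearEquiv.ofBijective M ⟨hinj, hsurj⟩
  let R : X →L[𝕜] X := LinearMap.mkContinuous (A.domain.subtype ∘ₗ e.symm.toLinearMap) l⁻¹
    fun f => by
      have h1 := hdiss (e.symm f)
      have h2 : M (e.symm f) = f := e.apply_symm_apply f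
      rw [← hM, h2] at h1
      rw [le_inv_mul_iff₀ hl]
      exact h1
  refine ⟨R, LinearMap.mkContinuous_norm_le _ (inv_pos.mpr hl).le _, fun u => ?_, fun f => hsurj f⟩
  change ((e.symm (M u) : A.domain) : X) = u
  exact congrArg Subtype.val (e.symm_apply_apply u)

/-- **Hille–Yosida theorem**, contraction case. The Yosida approximations
`B n = l n (l n (l n - A)⁻¹ - 1)`, with `l n → ∞`, are commuting bounded operators which generate
contraction semigroups and converge to `A` on its domain. -/
theorem generatesC0Semigroup_of_dissipative [CompleteSpace X] {A : X →ₗ.[𝕜] X}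
    (hdense : Dense (A.domain : Set X)) (hA : A.IsClosed) {l₀ : ℝ}
    (hdiss : ∀ l : ℝ, 0 < l → ∀ u : A.domain, l * ‖(u : X)‖ ≤ ‖(l : 𝕜) • (u : X) - A u‖)
    (hrange : ∀ l : ℝ, l₀ < l → Dense (range fun u : A.domain => (l : 𝕜) • (u : X) - A u)) :
    GeneratesC0Semigroup A := by
  set l : ℕ → ℝ := fun n => max l₀ 0 + (n + 1) with hl
  have hl1 : ∀ n, l₀ < l n := fun n =>
    (le_max_left l₀ 0).trans_lt (lt_add_of_pos_right _ (by positivity))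
  have hl0 : ∀ n, 0 < l n := fun n =>
    (le_max_right l₀ 0).trans_lt (lt_add_of_pos_right _ (by positivity))
  have hlinj : ∀ m n, l m = l n → m = n := fun m n h => by
    simp only [hl] at h
    exact_mod_cast (add_right_cancel (add_left_cancel h))
  have hltop : Tendsto l atTop atTop :=
    tendsto_atTop_add_const_left _ _ (tendsto_atTop_add_const_right _ _ tendsto_natCast_atTop_atTop)
  choose R hRn hRu hRs using
    fun n => exists_resolvent hA (hl0 n) (hdiss (l n) (hl0 n)) (hrange (l n) (hl1 n))
  have hlne : ∀ n, ((l n : ℝ) : 𝕜) ≠ 0 := fun n => by exact_mod_cast (hl0 n).ne'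
  set J : ℕ → X →L[𝕜] X := fun n => (l n : 𝕜) • R n with hJ
  have hJ1 : ∀ n, ‖J n‖ ≤ 1 := by
    intro n
    rw [hJ, norm_smul, RCLike.norm_ofReal, abs_of_pos (hl0 n)]
    calc l n * ‖R n‖ ≤ l n * (l n)⁻¹ := mul_le_mul_of_nonneg_left (hRn n) (hl0 n).le
      _ = 1 := mul_inv_cancel₀ (hl0 n).ne'
  -- the resolvent identity
  have hres : ∀ m n f, R m f = R n f + ((l n : 𝕜) - l m) • R n (R m f) := by
    intro m n f
    obtain ⟨u, hu⟩ := hRs m f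
    have h1 : R m f = u := by rw [← hu, hRu]
    have h2 : (l n : 𝕜) • (u : X) - A u = f + ((l n : 𝕜) - l m) • (u : X) := by
      rw [← hu]
      module
    have h3 := hRu n u
    rw [h2, map_add, map_smul] at h3
    rw [h1, h3]
  have hRcomm : ∀ m n, Commute (R m) (R n) := by
    intro m n
    rcases eq_or_ne m n with rfl | hmn
    · exact Commute.refl _
    · ext f
      have h1 := hres m n f
      have h2 := hres n m f
      have hne : ((l n : 𝕜) - l m) ≠ 0 := by
        intro h
        have : (l n : 𝕜) = l m := sub_eq_zero.mp h
        exact hmn (hlinj n m (by exact_mod_cast this)).symm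
      have h3 : ((l n : 𝕜) - l m) • R m (R n f) = ((l n : 𝕜) - l m) • R n (R m f) := by
        rw [h2] at h1
        have h4 := sub_eq_zero.mpr h1
        rw [← sub_eq_zero, ← h4]
        module
      exact smul_right_injective X hne h3
  set B : ℕ → X →L[𝕜] X := fun n => (l n : 𝕜) • (J n - 1) with hB
  have hBcomm : ∀ m n, Commute (B m) (B n) := by
    intro m n
    have h1 : Commute (J m) (J n) := ((hRcomm m n).smul_left _).smul_right _
    have h2 : Commute (J m - 1) (J n - 1) :=
      (h1.sub_left (Commute.one_left _)).sub_right (Commute.one_right _)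
    exact (h2.smul_left _).smul_right _
  have hBexp : ∀ n, ∀ s : ℝ, 0 ≤ s → ‖NormedSpace.exp ((s : 𝕜) • B n)‖ ≤ 1 := by
    intro n s hs
    rw [hB, smul_smul, ← RCLike.ofReal_mul]
    exact norm_exp_smul_sub_one_le (hJ1 n) (mul_nonneg hs (hl0 n).le)
  have hRA : ∀ n (u : A.domain), J n u - u = R n (A u) := by
    intro n u
    have h1 := hRu n u
    rw [map_sub, map_smul] at h1
    rw [hJ, smul_apply]
    nth_rewrite 2 [← h1]
    abel
  have hBA : ∀ n (u : A.domain), B n u = J n (A u) := by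
    intro n u
    change (l n : 𝕜) • (J n u - u) = (l n : 𝕜) • R n (A u)
    rw [hRA]
  have hJlim : ∀ y, Tendsto (fun n => J n y) atTop (𝓝 y) := by
    intro y
    have hdom : ∀ u : A.domain, Tendsto (fun n => J n u) atTop (𝓝 (u : X)) := by
      intro u
      rw [tendsto_iff_norm_sub_tendsto_zero]
      have h1 : Tendsto (fun n => (l n)⁻¹ * ‖A u‖) atTop (𝓝 0) := by
        simpa using (tendsto_inv_atTop_zero.comp hltop).mul_const ‖A u‖
      refine squeeze_zero (fun _ => norm_nonneg _) (fun n => ?_) h1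
      rw [hRA]
      exact (R n).le_of_opNorm_le (hRn n) _
    rw [Metric.tendsto_atTop]
    intro ε hε
    obtain ⟨u, hu, hyu⟩ := hdense.exists_dist_lt y (ε := ε / 3) (by positivity)
    obtain ⟨N, hN⟩ := Metric.tendsto_atTop.mp (hdom ⟨u, hu⟩) (ε / 3) (by positivity)
    refine ⟨N, fun n hn => ?_⟩
    have h1 : dist (J n y) (J n u) < ε / 3 := by
      rw [dist_eq_norm, ← map_sub]
      refine lt_of_le_of_lt ((J n).norm_apply_le_of_norm_le_one (hJ1 n) _) ?_
      rwa [← dist_eq_norm]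
    have h2 := hN n hn
    have h3 := dist_triangle4 (J n y) (J n u) u y
    rw [dist_comm u y] at h3
    simp only at h2
    linarith
  classical
  let L : X → X := fun x => if h : x ∈ A.domain then A ⟨x, h⟩ else 0
  have hLA : ∀ u : A.domain, L u = A u := fun u => dif_pos u.2
  obtain ⟨S, hS, hS1, hSL⟩ := exists_isC0Semigroup_of_tendsto_generators hBcomm hBexp hdense
    (L := L) (fun x hx => by
      have h1 := hLA ⟨x, hx⟩
      simp only at h1
      rw [h1]
      exact (hJlim _).congr fun n => (hBA n ⟨x, hx⟩).symm)
  have hSA : ∀ u : A.domain, HasGeneratorValue S u (A u) := fun u => by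
    rw [← hLA]
    exact hSL u u.2
  refine ⟨S, hS, LinearPMap.eq_of_eq_graph (le_antisymm ?_ ?_)⟩
  · -- `l - A` is onto and `l` is no eigenvalue of the generator, so the latter extends no further
    rintro ⟨x, y⟩ hxy
    rw [mem_graph_semigroupGenerator] at hxy
    obtain ⟨u, hu⟩ := hRs 0 ((l 0 : 𝕜) • x - y)
    have h1 : HasGeneratorValue S ((u : X) - x) ((l 0 : 𝕜) • ((u : X) - x)) := by
      have h2 := (hSA u).sub hxy
      have h3 : A u - y = (l 0 : 𝕜) • ((u : X) - x) := by
        have h4 : A u = (l 0 : 𝕜) • (u : X) - ((l 0 : 𝕜) • x - y) := by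
          rw [← hu]
          abel
        rw [h4]
        module
      rwa [h3] at h2
    have h2 := h1.eq_zero_of_norm_le_one hS1 (hl0 0)
    have hux : (u : X) = x := sub_eq_zero.mp h2
    rw [LinearPMap.mem_graph_iff]
    refine ⟨u, hux, ?_⟩
    rw [hux] at hu
    exact sub_right_injective hu
  · rintro ⟨x, y⟩ hxy
    obtain ⟨u, hu, huy⟩ := LinearPMap.mem_graph_iff _ |>.mp hxy
    simp only at hu huy
    rw [mem_graph_semigroupGenerator, ← hu, ← huy]
    exact hSA u

/-- The operator `A + c` on the domain of `A`. -/
def LinearPMap.addScalar (A : X →ₗ.[𝕜] X) (c : 𝕜) : X →ₗ.[𝕜] X :=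
  ⟨A.domain, A.toFun + c • A.domain.subtype⟩

lemma LinearPMap.mem_graph_addScalar {A : X →ₗ.[𝕜] X} {c : 𝕜} {x y : X} :
    (x, y) ∈ (A.addScalar c).graph ↔ (x, y - c • x) ∈ A.graph := by
  simp only [LinearPMap.mem_graph_iff]
  constructor
  · rintro ⟨u, hu, huy⟩
    refine ⟨u, hu, ?_⟩
    rw [← huy, ← hu]
    change A u = (A u + c • (u : X)) - c • (u : X)
    abel
  · rintro ⟨u, hu, huy⟩
    refine ⟨u, hu, ?_⟩
    change A u + c • (u : X) = y
    rw [huy, hu]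
    abel

lemma LinearPMap.IsClosed.addScalar {A : X →ₗ.[𝕜] X} (hA : A.IsClosed) (c : 𝕜) :
    (A.addScalar c).IsClosed := by
  have h1 : Continuous fun p : X × X => (p.1, p.2 - c • p.1) := by fun_prop
  have h2 := _root_.IsClosed.preimage h1 hA
  refine (congrArg _root_.IsClosed ?_).mp h2
  ext ⟨x, y⟩
  exact LinearPMap.mem_graph_addScalar.symm

lemma GeneratesC0Semigroup.of_addScalar {A : X →ₗ.[𝕜] X} {c : ℝ}
    (h : GeneratesC0Semigroup (A.addScalar (c : 𝕜))) : GeneratesC0Semigroup A := by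
  obtain ⟨S, hS, hSA⟩ := h
  have hT := hS.exp_smul (-c)
  refine ⟨_, hT, LinearPMap.eq_of_eq_graph ?_⟩
  ext ⟨x, y⟩
  have key : HasGeneratorValue S x (y + (c : 𝕜) • x) ↔ (x, y) ∈ A.graph := by
    rw [← mem_graph_semigroupGenerator, hSA, LinearPMap.mem_graph_addScalar, add_sub_cancel_right]
  rw [mem_graph_semigroupGenerator, ← key]
  constructor
  · intro h
    have h1 := h.exp_smul c
    have h2 : (fun t : ℝ≥0 => ((Real.exp (c * t) : ℝ) : 𝕜) • ((Real.exp (-c * t) : ℝ) : 𝕜) • S t)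
        = S := by
      funext t
      rw [smul_smul, ← RCLike.ofReal_mul, ← Real.exp_add]
      simp
    rwa [h2] at h1
  · intro h
    have h1 := h.exp_smul (-c)
    have h2 : y + (c : 𝕜) • x + ((-c : ℝ) : 𝕜) • x = y := by
      push_cast
      module
    rwa [h2] at h1

/-- **Hille–Yosida theorem** for a densely defined closed operator `A` such that `A - w` is
dissipative and `l - A` has dense range for all large `l`. -/
theorem generatesC0Semigroup_of_quasiDissipative [CompleteSpace X] {A : X →ₗ.[𝕜] X}
    (hdense : Dense (A.domain : Set X)) (hA : A.IsClosed) {w l₀ : ℝ}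
    (hdiss : ∀ l : ℝ, w < l → ∀ u : A.domain, (l - w) * ‖(u : X)‖ ≤ ‖(l : 𝕜) • (u : X) - A u‖)
    (hrange : ∀ l : ℝ, l₀ < l → Dense (range fun u : A.domain => (l : 𝕜) • (u : X) - A u)) :
    GeneratesC0Semigroup A := by
  have e : ∀ (l : ℝ) (u : A.domain), (l : 𝕜) • (u : X) - A.addScalar ((-w : ℝ) : 𝕜) u
      = ((l + w : ℝ) : 𝕜) • (u : X) - A u := by
    intro l u
    change (l : 𝕜) • (u : X) - (A u + ((-w : ℝ) : 𝕜) • (u : X)) = _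
    push_cast
    module
  refine GeneratesC0Semigroup.of_addScalar (c := -w)
    (generatesC0Semigroup_of_dissipative (l₀ := l₀ - w) hdense (hA.addScalar _) ?_ ?_)
  · intro l hl u
    have h1 := hdiss (l + w) (by linarith) u
    rw [add_sub_cancel_right] at h1
    exact h1.trans_eq (congrArg norm (e l u).symm)
  · intro l hl
    have h1 := hrange (l + w) (by linarith)
    refine (congrArg Dense (congrArg range ?_)).mp h1
    funext u
    exact (e l u).symm

end HilleYosida

namespace HalfLine

variable {𝕜 : Type*} [RCLike 𝕜]

/-! ### Weak derivatives on the half-line -/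

/-- The class in `L²(ℝ₊)` of a real-valued function, regarded as `𝕜`-valued. -/
def realToL2 (𝕜 : Type*) [RCLike 𝕜] (f : ℝ → ℝ) (hf : MemLp f 2 (volume.restrict (Ioi 0))) :
    L2 𝕜 :=
  (hf.ofReal (K := 𝕜)).toLp _

lemma coeFn_realToL2 {f : ℝ → ℝ} (hf : MemLp f 2 (volume.restrict (Ioi 0))) :
    ∀ᵐ x ∂(volume.restrict (Ioi (0 : ℝ))), realToL2 𝕜 f hf x = (f x : 𝕜) :=
  MemLp.coeFn_toLp (hf.ofReal (K := 𝕜))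

lemma inner_realToL2 {f : ℝ → ℝ} (hf : MemLp f 2 (volume.restrict (Ioi 0))) (u : L2 𝕜) :
    inner 𝕜 (realToL2 𝕜 f hf) u = ∫ x in Ioi (0 : ℝ), f x • u x := by
  rw [L2.inner_def]
  refine integral_congr_ae ?_
  filter_upwards [coeFn_realToL2 (𝕜 := 𝕜) hf] with x hx
  rw [hx, RCLike.inner_apply, RCLike.conj_ofReal, RCLike.real_smul_eq_coe_mul, mul_comm]

lemma memLp_of_hasCompactSupport {f : ℝ → ℝ} (hf : Continuous f) (hc : HasCompactSupport f) :
    MemLp f 2 (volume.restrict (Ioi 0)) :=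
  (hf.memLp_of_hasCompactSupport hc).restrict _

/-- Weak differentiation is a closed operator. -/
lemma IsWeakDeriv.of_tendsto {u v : ℕ → L2 𝕜} {u₀ v₀ : L2 𝕜} (h : ∀ n, IsWeakDeriv (u n) (v n))
    (hu : Tendsto u atTop (𝓝 u₀)) (hv : Tendsto v atTop (𝓝 v₀)) : IsWeakDeriv u₀ v₀ := by
  intro φ hφ hc hs
  have hd := memLp_of_hasCompactSupport (hφ.continuous_deriv (by simp)) hc.deriv
  have h0 := memLp_of_hasCompactSupport hφ.continuous hc
  rw [← inner_realToL2 hd, ← inner_realToL2 h0]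
  refine tendsto_nhds_unique (tendsto_const_nhds.inner hu) ?_
  refine (tendsto_const_nhds.inner hv).neg.congr fun n => ?_
  have := h n φ hφ hc hs
  rw [← inner_realToL2 hd, ← inner_realToL2 h0] at this
  exact this.symm

/-- A subspace of `L²(ℝ₊)` containing all real test functions is dense. -/
lemma dense_of_forall_test_mem {V : Submodule 𝕜 (L2 𝕜)}
    (hV : ∀ φ : ℝ → ℝ, ContDiff ℝ ∞ φ → HasCompactSupport φ → tsupport φ ⊆ Ioi 0 →
      ∀ h : MemLp φ 2 (volume.restrict (Ioi 0)), realToL2 𝕜 φ h ∈ V) : Dense (V : Set (L2 𝕜)) := by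
  rw [Submodule.dense_iff_topologicalClosure_eq_top, Submodule.topologicalClosure_eq_top_iff,
    Submodule.eq_bot_iff]
  intro g hg
  have key : ∀ᵐ x ∂(volume : Measure ℝ), x ∈ Ioi (0 : ℝ) → g x = 0 := by
    refine isOpen_Ioi.ae_eq_zero_of_integral_contDiff_smul_eq_zero
      (locallyIntegrableOn_L2 g) fun φ hφ hc hs => ?_
    have h0 := memLp_of_hasCompactSupport hφ.continuous hc
    have h1 := (Submodule.mem_orthogonal V g).mp hg _ (hV φ hφ hc hs h0)
    rw [inner_realToL2] at h1
    rw [← h1]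
    refine (setIntegral_eq_integral_of_forall_compl_eq_zero fun x hx => ?_).symm
    rw [image_eq_zero_of_notMem_tsupport fun h => hx (hs h), zero_smul]
  rw [Lp.eq_zero_iff_ae_eq_zero, EventuallyEq, ae_restrict_iff' measurableSet_Ioi]
  exact key

lemma intervalIntegrable_L2 (v : L2 𝕜) {R : ℝ} (hR : 0 ≤ R) :
    IntervalIntegrable (v : ℝ → 𝕜) volume 0 R := by
  rw [intervalIntegrable_iff_integrableOn_Ioc_of_le hR]
  have h1 : MemLp (v : ℝ → 𝕜) 2 (volume.restrict (Ioc 0 R)) :=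
    (Lp.memLp v).mono_measure (Measure.restrict_mono Ioc_subset_Ioi_self le_rfl)
  exact h1.integrable (by norm_num)

lemma continuousOn_primitive_L2 (v : L2 𝕜) :
    ContinuousOn (fun x : ℝ => ∫ y in (0 : ℝ)..x, v y) (Ici 0) := by
  intro x hx
  have hx0 : (0 : ℝ) ≤ x := hx
  have h0 : (0 : ℝ) ≤ x + 1 := by linarith
  have h1 : ContinuousOn (fun x : ℝ => ∫ y in (0 : ℝ)..x, v y) (uIcc 0 (x + 1)) :=
    intervalIntegral.continuousOn_primitive_interval
      (intervalIntegrable_L2 v h0 |>.1.congr_set_ae (by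
        rw [uIcc_of_le h0]; exact Ioc_ae_eq_Icc.symm))
  rw [uIcc_of_le h0] at h1
  refine (h1 x ⟨hx0, by linarith⟩).mono_of_mem_nhdsWithin ?_
  have : Icc 0 (x + 1) = Ici 0 ∩ Iic (x + 1) := rfl
  rw [this]
  exact inter_mem self_mem_nhdsWithin
    (mem_nhdsWithin_of_mem_nhds (Iic_mem_nhds (by linarith)))

lemma integrable_smul_of_locallyIntegrableOn {ψ : ℝ → ℝ} (hψ : Continuous ψ)
    (hψc : HasCompactSupport ψ) (hψs : tsupport ψ ⊆ Ioi 0) {g : ℝ → 𝕜}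
    (hg : LocallyIntegrableOn g (Ioi 0) volume) : Integrable (fun x => ψ x • g x) := by
  have hK : IntegrableOn g (tsupport ψ) := hg.integrableOn_compact_subset hψs hψc
  have h2 : IntegrableOn (fun x => ψ x • g x) (tsupport ψ) :=
    hK.continuousOn_smul hψ.continuousOn hψc
  refine (integrableOn_iff_integrable_of_support_subset fun x hx => ?_).mp h2
  by_contra h
  exact hx (by simp [image_eq_zero_of_notMem_tsupport h])

/-- A locally integrable function whose weak derivative on `(0, ∞)` vanishes is almost everywhere
constant. -/
lemma exists_ae_eq_const_of_integral_deriv_smul_eq_zero {g : ℝ → 𝕜}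
    (hg : LocallyIntegrableOn g (Ioi 0) volume)
    (hg0 : ∀ φ : ℝ → ℝ, ContDiff ℝ ∞ φ → HasCompactSupport φ → tsupport φ ⊆ Ioi 0 →
      ∫ x, deriv φ x • g x = 0) :
    ∃ c : 𝕜, ∀ᵐ x ∂(volume : Measure ℝ), x ∈ Ioi (0 : ℝ) → g x - c = 0 := by
  -- the constant is the mean of `g` against a fixed bump function `ρ`, as `ψ - (∫ ψ) ρ` is the
  -- derivative of a test function for every test function `ψ`
  let B : ContDiffBump (2 : ℝ) := ⟨1 / 2, 1, by norm_num, by norm_num⟩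
  let ρ : ℝ → ℝ := B.normed volume
  have hρ : ContDiff ℝ ∞ ρ := B.contDiff_normed
  have hρc : HasCompactSupport ρ := B.hasCompactSupport_normed
  have hρs : tsupport ρ ⊆ Ioi 0 := by
    have : tsupport ρ = Metric.closedBall 2 1 := B.tsupport_normed_eq
    rw [this, Real.closedBall_eq_Icc]
    intro x hx
    have := hx.1
    simp only [mem_Ioi]
    linarith
  have hρ1 : ∫ x, ρ x = 1 := B.integral_normed
  set c : 𝕜 := ∫ x, ρ x • g x with hc
  have hcl : LocallyIntegrableOn (fun _ : ℝ => c) (Ioi 0) volume :=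
    continuousOn_const.locallyIntegrableOn measurableSet_Ioi
  refine ⟨c, isOpen_Ioi.ae_eq_zero_of_integral_contDiff_smul_eq_zero (hg.sub hcl)
    fun ψ hψ hψc hψs => ?_⟩
  set m : ℝ := ∫ x, ψ x with hm
  have hmc : HasCompactSupport fun x => m * ρ x := hρc.mul_left
  have hms : tsupport (fun x => m * ρ x) ⊆ Ioi 0 :=
    (tsupport_mul_subset_right (f := fun _ => m) (g := ρ)).trans hρs
  obtain ⟨φ, hφ, hφc, hφs, hφd⟩ := exists_primitive (ψ := fun x => ψ x - m * ρ x)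
    (hψ.sub (contDiff_const.mul hρ)) (hψc.sub hmc)
    ((tsupport_sub ψ (fun x => m * ρ x)).trans (union_subset hψs hms)) (by
      have hmi : Integrable fun x => m * ρ x :=
        (continuous_const.mul hρ.continuous).integrable_of_hasCompactSupport hmc
      rw [integral_sub (hψ.continuous.integrable_of_hasCompactSupport hψc) hmi,
        integral_const_mul, hρ1, mul_one, ← hm, sub_self])
  have h1 := hg0 φ hφ hφc hφs
  rw [hφd] at h1
  have hi1 := integrable_smul_of_locallyIntegrableOn hψ.continuous hψc hψs hg
  have hi2 := integrable_smul_of_locallyIntegrableOn hρ.continuous hρc hρs hg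
  have hi3 : Integrable fun x => m • (ρ x • g x) := hi2.smul m
  have h2 : ∫ x, (ψ x - m * ρ x) • g x = (∫ x, ψ x • g x) - m • c := by
    simp_rw [sub_smul, mul_smul]
    rw [integral_sub hi1 hi3, integral_smul]
  change ∫ x, ψ x • (g x - c) = 0
  simp_rw [smul_sub _ _ c]
  rw [integral_sub hi1 (integrable_smul_of_locallyIntegrableOn hψ.continuous hψc hψs hcl),
    integral_smul_const, ← hm, ← h2, h1]

/-- Functions in `H¹(ℝ₊)` are primitives of their weak derivatives. -/
lemma IsWeakDeriv.ae_eq_trace_add_integral {u v : L2 𝕜} (hv : IsWeakDeriv u v) :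
    ∀ᵐ x ∂(volume.restrict (Ioi (0 : ℝ))), u x = trace u + ∫ y in (0 : ℝ)..x, v y := by
  set f : ℝ → 𝕜 := fun x => ∫ y in (0 : ℝ)..x, v y with hf
  have hfc : ContinuousOn f (Ici 0) := continuousOn_primitive_L2 v
  have hfl : LocallyIntegrableOn f (Ioi 0) volume :=
    (hfc.mono Ioi_subset_Ici_self).locallyIntegrableOn measurableSet_Ioi
  have hset : ∀ ψ : ℝ → ℝ, tsupport ψ ⊆ Ioi 0 → ∀ g : ℝ → 𝕜,
      ∫ x in Ioi (0 : ℝ), ψ x • g x = ∫ x, ψ x • g x := by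
    intro ψ hψ g
    refine setIntegral_eq_integral_of_forall_compl_eq_zero fun x hx => ?_
    rw [image_eq_zero_of_notMem_tsupport fun h => hx (hψ h), zero_smul]
  have hg0 : ∀ φ : ℝ → ℝ, ContDiff ℝ ∞ φ → HasCompactSupport φ → tsupport φ ⊆ Ioi 0 →
      ∫ x, deriv φ x • (u x - f x) = 0 := by
    intro φ hφ hc hs
    have hs' : tsupport (deriv φ) ⊆ Ioi 0 := (tsupport_deriv_subset (𝕜 := ℝ)).trans hs
    have hdc : Continuous (deriv φ) := hφ.continuous_deriv (by simp)
    obtain ⟨R, hR⟩ : ∃ R : ℝ, ∀ x ∈ tsupport φ, x ≤ R :=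
      (show IsCompact (tsupport φ) from hc).bddAbove
    -- truncating `v` to `(0, R]` does not change the integrals against `φ` and `φ'`
    let V : ℝ → 𝕜 := (Ioc 0 R).indicator v
    have hVi : Integrable V := by
      refine (integrable_indicator_iff measurableSet_Ioc).mpr ?_
      rcases le_total 0 R with h | h
      · exact (intervalIntegrable_L2 v h).1
      · rw [Ioc_eq_empty (not_lt.mpr h)]
        exact integrableOn_empty
    have h1 := integral_deriv_smul_primitive hVi hφ hc
    have h2 : ∫ x, deriv φ x • ∫ y in Iio x, V y = ∫ x, deriv φ x • f x := by
      refine integral_congr_ae (ae_of_all _ fun x => ?_)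
      by_cases hx : x ∈ tsupport φ
      · have hxR := hR x hx
        change deriv φ x • ∫ y in Iio x, V y = deriv φ x • ∫ y in (0 : ℝ)..x, v y
        congr 1
        rw [← integral_Iic_eq_integral_Iio, intervalIntegral.integral_of_le (hs hx).le,
          ← integral_indicator measurableSet_Iic, ← integral_indicator measurableSet_Ioc]
        congr 1
        ext y
        simp only [V, indicator_apply, mem_Iic, mem_Ioc]
        by_cases hy : y ≤ x
        · have : y ≤ R := hy.trans hxR
          simp [hy, this]
        · simp [hy]
      · have : deriv φ x = 0 :=
          image_eq_zero_of_notMem_tsupport fun h => hx (tsupport_deriv_subset (𝕜 := ℝ) h)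
        simp [this]
    have h3 : ∫ y, φ y • V y = ∫ y, φ y • v y := by
      refine integral_congr_ae (ae_of_all _ fun y => ?_)
      by_cases hy : y ∈ tsupport φ
      · have : y ∈ Ioc 0 R := ⟨hs hy, hR y hy⟩
        simp [V, this]
      · simp [image_eq_zero_of_notMem_tsupport hy]
    have h4 := hv φ hφ hc hs
    rw [hset _ hs', hset _ hs] at h4
    simp_rw [smul_sub]
    rw [integral_sub (integrable_smul_of_locallyIntegrableOn hdc hc.deriv hs'
        (locallyIntegrableOn_L2 u))
      (integrable_smul_of_locallyIntegrableOn hdc hc.deriv hs' hfl), h4, ← h2, h1, h3, sub_self]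
  obtain ⟨c, hc⟩ := exists_ae_eq_const_of_integral_deriv_smul_eq_zero
    ((locallyIntegrableOn_L2 u).sub hfl) hg0
  have hae : ∀ᵐ x ∂(volume.restrict (Ioi (0 : ℝ))), u x = c + f x := by
    rw [ae_restrict_iff' measurableSet_Ioi]
    filter_upwards [hc] with x hx hx0
    have := hx hx0
    simp only [Pi.sub_apply] at this
    linear_combination this
  have htr : trace u = c :=
    HasTrace.trace_eq ⟨fun x => c + f x, continuousOn_const.add hfc, hae, by simp [hf]⟩
  rw [htr]
  exact hae

/-- Integration by parts for primitives of integrable functions. -/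
lemma integral_mul_primitive_add_primitive_mul {p q : ℝ → ℝ} {R : ℝ}
    (hp : IntervalIntegrable p volume 0 R) (hq : IntervalIntegrable q volume 0 R) (a b : ℝ) :
    ∫ x in (0 : ℝ)..R, (p x * (b + ∫ y in (0 : ℝ)..x, q y) + (a + ∫ y in (0 : ℝ)..x, p y) * q x)
      = (a + ∫ y in (0 : ℝ)..R, p y) * (b + ∫ y in (0 : ℝ)..R, q y) - a * b := by
  have hac : ∀ (r : ℝ → ℝ) (c : ℝ), IntervalIntegrable r volume 0 R →
      AbsolutelyContinuousOnInterval (fun x => c + ∫ y in (0 : ℝ)..x, r y) 0 R := by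
    intro r c hr
    have h1 : AbsolutelyContinuousOnInterval (fun _ : ℝ => c) 0 R :=
      (LipschitzWith.const c).lipschitzOnWith.absolutelyContinuousOnInterval
    exact h1.add (hr.absolutelyContinuousOnInterval_intervalIntegral left_mem_uIcc)
  have hder : ∀ (r : ℝ → ℝ) (c : ℝ), IntervalIntegrable r volume 0 R →
      ∀ᵐ x, x ∈ uIcc 0 R → deriv (fun x => c + ∫ y in (0 : ℝ)..x, r y) x = r x := by
    intro r c hr
    filter_upwards [hr.ae_hasDerivAt_integral] with x hx hxR
    exact ((hx hxR 0 left_mem_uIcc).const_add c).deriv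
  have h := (hac p a hp).integral_deriv_mul_eq_sub (hac q b hq)
  simp only [intervalIntegral.integral_same, add_zero] at h
  rw [← h]
  refine intervalIntegral.integral_congr_ae ?_
  filter_upwards [hder p a hp, hder q b hq] with x h1 h2 hx
  rw [h1 (uIoc_subset_uIcc hx), h2 (uIoc_subset_uIcc hx)]

/-- Integration by parts in `H¹(ℝ₊)`. The boundary term at infinity vanishes because the product
is integrable and has a limit. -/
lemma IsWeakDeriv.re_inner_add_re_inner {u v u' v' : L2 𝕜} (hu : IsWeakDeriv u u')
    (hv : IsWeakDeriv v v') :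
    RCLike.re (inner 𝕜 u' v) + RCLike.re (inner 𝕜 u v')
      = -RCLike.re (inner 𝕜 (trace u) (trace v)) := by
  set a := trace u with ha
  set b := trace v with hb
  set U : ℝ → 𝕜 := fun x => a + ∫ y in (0 : ℝ)..x, u' y with hU
  set V : ℝ → 𝕜 := fun x => b + ∫ y in (0 : ℝ)..x, v' y with hV
  have hUu := hu.ae_eq_trace_add_integral
  have hVv := hv.ae_eq_trace_add_integral
  have hre : ∀ z w : 𝕜, RCLike.re (inner 𝕜 z w)
      = RCLike.re z * RCLike.re w + RCLike.im z * RCLike.im w := by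
    intro z w
    rw [RCLike.inner_apply, RCLike.mul_re, RCLike.conj_re, RCLike.conj_im]
    ring
  set G : ℝ → ℝ := fun x => RCLike.re (inner 𝕜 (u' x) (v x)) + RCLike.re (inner 𝕜 (u x) (v' x))
    with hG
  have hG1 : IntegrableOn (fun x => RCLike.re (inner 𝕜 (u' x) (v x))) (Ioi 0) :=
    (L2.integrable_inner (𝕜 := 𝕜) u' v).re
  have hG2 : IntegrableOn (fun x => RCLike.re (inner 𝕜 (u x) (v' x))) (Ioi 0) :=
    (L2.integrable_inner (𝕜 := 𝕜) u v').re
  have hGi : IntegrableOn G (Ioi 0) := hG1.add hG2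
  set F : ℝ → ℝ := fun x => RCLike.re (inner 𝕜 (U x) (V x)) with hF
  have hFi : IntegrableOn F (Ioi 0) := by
    have h1 : IntegrableOn (fun x => RCLike.re (inner 𝕜 (u x) (v x))) (Ioi 0) :=
      (L2.integrable_inner (𝕜 := 𝕜) u v).re
    refine h1.congr ?_
    filter_upwards [hUu, hVv] with x hx1 hx2
    simp only [hF, hU, hV]
    rw [hx1, hx2]
  have hparts : ∀ R : ℝ, 0 ≤ R → ∫ x in (0 : ℝ)..R, G x = F R - RCLike.re (inner 𝕜 a b) := by
    intro R hR
    have hi : ∀ w : L2 𝕜, IntervalIntegrable (fun x => RCLike.re (w x)) volume 0 R ∧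
        IntervalIntegrable (fun x => RCLike.im (w x)) volume 0 R := fun w =>
      ⟨⟨(intervalIntegrable_L2 w hR).1.re, (intervalIntegrable_L2 w hR).2.re⟩,
        ⟨(intervalIntegrable_L2 w hR).1.im, (intervalIntegrable_L2 w hR).2.im⟩⟩
    have hpr : ∀ (w : L2 𝕜) (c : 𝕜), ∀ x, 0 ≤ x →
        RCLike.re (c + ∫ y in (0 : ℝ)..x, w y)
            = RCLike.re c + ∫ y in (0 : ℝ)..x, RCLike.re (w y) ∧
          RCLike.im (c + ∫ y in (0 : ℝ)..x, w y)
            = RCLike.im c + ∫ y in (0 : ℝ)..x, RCLike.im (w y) := by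
      intro w c x hx
      rw [map_add, map_add]
      constructor
      · congr 1
        exact ((RCLike.reCLM (K := 𝕜)).intervalIntegral_comp_comm (intervalIntegrable_L2 w hx)).symm
      · congr 1
        exact ((RCLike.imCLM (K := 𝕜)).intervalIntegral_comp_comm (intervalIntegrable_L2 w hx)).symm
    have hr := integral_mul_primitive_add_primitive_mul (hi u').1 (hi v').1 (RCLike.re a)
      (RCLike.re b)
    have hm := integral_mul_primitive_add_primitive_mul (hi u').2 (hi v').2 (RCLike.im a)
      (RCLike.im b)
    have hii : ∀ (p q : ℝ → ℝ) (c d : ℝ), IntervalIntegrable p volume 0 R →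
        IntervalIntegrable q volume 0 R → IntervalIntegrable (fun x =>
          p x * (d + ∫ y in (0 : ℝ)..x, q y) + (c + ∫ y in (0 : ℝ)..x, p y) * q x) volume 0 R := by
      intro p q c d hp hq
      have hcont : ∀ r : ℝ → ℝ, IntervalIntegrable r volume 0 R → ∀ e : ℝ,
          ContinuousOn (fun x => e + ∫ y in (0 : ℝ)..x, r y) (uIcc 0 R) := fun r hr e =>
        continuousOn_const.add
          (hr.absolutelyContinuousOnInterval_intervalIntegral left_mem_uIcc).continuousOn
      exact (hp.mul_continuousOn (hcont q hq d)).add (hq.continuousOn_mul (hcont p hp c))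
    have hsum := intervalIntegral.integral_add
      (hii _ _ (RCLike.re a) (RCLike.re b) (hi u').1 (hi v').1)
      (hii _ _ (RCLike.im a) (RCLike.im b) (hi u').2 (hi v').2)
    rw [hr, hm] at hsum
    refine Eq.trans ?_ (hsum.trans ?_)
    · refine intervalIntegral.integral_congr_ae ?_
      rw [ae_restrict_iff' measurableSet_Ioi] at hUu hVv
      filter_upwards [hUu, hVv] with x hx1 hx2 hx
      rw [uIoc_of_le hR] at hx
      simp only [hG]
      rw [hx1 hx.1, hx2 hx.1, hre, hre, (hpr u' a x hx.1.le).1, (hpr u' a x hx.1.le).2,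
        (hpr v' b x hx.1.le).1, (hpr v' b x hx.1.le).2]
      ring
    · simp only [hF, hre, hU, hV]
      rw [(hpr u' a R hR).1, (hpr u' a R hR).2, (hpr v' b R hR).1, (hpr v' b R hR).2]
      ring
  have hlim : Tendsto F atTop (𝓝 ((∫ x in Ioi (0 : ℝ), G x) + RCLike.re (inner 𝕜 a b))) := by
    refine ((intervalIntegral_tendsto_integral_Ioi 0 hGi tendsto_id).add_const _).congr' ?_
    filter_upwards [eventually_ge_atTop 0] with R hR
    rw [id, hparts R hR, sub_add_cancel]
  have hzero := IntegrableAtFilter.eq_zero_of_tendsto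
    (l := atTop) ⟨Ioi 0, Ioi_mem_atTop 0, hFi⟩ (fun s hs => by
      obtain ⟨c, hc⟩ := mem_atTop_sets.mp hs
      exact measure_mono_top (show Ici c ⊆ s from fun x hx => hc x hx) Real.volume_Ici) hlim
  have hint : ∫ x in Ioi (0 : ℝ), G x
      = RCLike.re (inner 𝕜 u' v) + RCLike.re (inner 𝕜 u v') := by
    rw [L2.inner_def, L2.inner_def, ← integral_re (L2.integrable_inner u' v),
      ← integral_re (L2.integrable_inner u v')]
    exact integral_add hG1 hG2
  linarith

/-! ### The trace is continuous on `H¹(ℝ₊)` -/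

lemma IsWeakDeriv.two_mul_re_inner {u u' : L2 𝕜} (h : IsWeakDeriv u u') :
    2 * RCLike.re (inner 𝕜 u' u) = -‖trace u‖ ^ 2 := by
  have h1 := h.re_inner_add_re_inner h
  rw [inner_re_symm (𝕜 := 𝕜) u u', ← norm_sq_eq_re_inner (𝕜 := 𝕜)] at h1
  linarith

lemma IsWeakDeriv.norm_trace_sq_le {u u' : L2 𝕜} (h : IsWeakDeriv u u') :
    ‖trace u‖ ^ 2 ≤ 2 * (‖u'‖ * ‖u‖) := by
  have h1 := h.two_mul_re_inner
  have h2 := (abs_le.mp (RCLike.abs_re_le_norm (inner 𝕜 u' u))).1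
  have h3 := norm_inner_le_norm (𝕜 := 𝕜) u' u
  linarith

lemma IsWeakDeriv.tendsto_trace {u v : ℕ → L2 𝕜} {u₀ v₀ : L2 𝕜}
    (h : ∀ n, IsWeakDeriv (u n) (v n)) (hu : Tendsto u atTop (𝓝 u₀))
    (hv : Tendsto v atTop (𝓝 v₀)) : Tendsto (fun n => trace (u n)) atTop (𝓝 (trace u₀)) := by
  have h0 := IsWeakDeriv.of_tendsto h hu hv
  have hsub : ∀ n, IsWeakDeriv (u n - u₀) (v n - v₀) := fun n => by
    have := (h n).add (h0.smul (-1))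
    rwa [neg_one_smul, neg_one_smul, ← sub_eq_add_neg, ← sub_eq_add_neg] at this
  have htr : ∀ n, trace (u n - u₀) = trace (u n) - trace u₀ := fun n => by
    have h1 := trace_add (u := u n - u₀) (v := u₀) ⟨_, hsub n⟩ ⟨_, h0⟩
    rw [sub_add_cancel] at h1
    rw [h1, add_sub_cancel_right]
  have hsq : Tendsto (fun n => ‖trace (u n) - trace u₀‖ ^ 2) atTop (𝓝 0) := by
    have h1 : Tendsto (fun n => 2 * (‖v n - v₀‖ * ‖u n - u₀‖)) atTop (𝓝 0) := by
      simpa using ((tendsto_iff_norm_sub_tendsto_zero.mp hv).mul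
        (tendsto_iff_norm_sub_tendsto_zero.mp hu)).const_mul 2
    refine squeeze_zero (fun _ => by positivity) (fun n => ?_) h1
    rw [← htr]
    exact (hsub n).norm_trace_sq_le
  rw [tendsto_iff_norm_sub_tendsto_zero]
  have h2 := (Real.continuous_sqrt.tendsto 0).comp hsq
  simp only [Real.sqrt_zero] at h2
  refine h2.congr fun n => ?_
  exact Real.sqrt_sq (norm_nonneg _)

/-! ### The Robin operator is quasi-dissipative and closed -/

lemma robinOperator_apply {α β γ κ : ℝ} (u : (robinOperator 𝕜 α β γ κ).domain) :
    robinOperator 𝕜 α β γ κ u = (α : 𝕜) • weakDeriv (weakDeriv (u : L2 𝕜))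
      + (β : 𝕜) • weakDeriv (u : L2 𝕜) + (γ : 𝕜) • (u : L2 𝕜) := rfl

/-- The growth bound for the semigroup generated by the Robin operator that results from the
energy estimate. -/
def robinBound (α β γ κ : ℝ) : ℝ := 2 * |α * κ - β / 2| ^ 2 / α + γ

/-- The energy estimate: integration by parts gives
`re ⟨Au, u⟩ = (ακ - β/2) |u(0)|² - α ‖u'‖² + γ ‖u‖²`, where `|u(0)|² ≤ 2 ‖u'‖ ‖u‖`. -/
lemma re_inner_robinOperator_add_le {α β γ κ : ℝ} (hα : 0 < α)
    (u : (robinOperator 𝕜 α β γ κ).domain) :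
    RCLike.re (inner 𝕜 (robinOperator 𝕜 α β γ κ u) (u : L2 𝕜))
      + α / 2 * ‖weakDeriv (u : L2 𝕜)‖ ^ 2 ≤ robinBound α β γ κ * ‖(u : L2 𝕜)‖ ^ 2 := by
  obtain ⟨u, ⟨hu1, hu2⟩, hbc⟩ := u
  have hd1 := isWeakDeriv_weakDeriv hu1
  have hd2 := isWeakDeriv_weakDeriv hu2
  rw [robinOperator_apply]
  simp only
  set v := weakDeriv u
  set z := weakDeriv v
  have e1 := hd1.two_mul_re_inner
  have e2 := hd2.re_inner_add_re_inner hd1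
  have e3 := hd1.norm_trace_sq_le
  have e4 : trace v = ((-κ : ℝ) : 𝕜) * trace u := by
    push_cast
    linear_combination hbc
  rw [e4, ← smul_eq_mul, inner_smul_left, RCLike.conj_ofReal, RCLike.re_ofReal_mul,
    ← norm_sq_eq_re_inner (𝕜 := 𝕜), ← norm_sq_eq_re_inner (𝕜 := 𝕜)] at e2
  rw [inner_add_left, inner_add_left, inner_smul_left, inner_smul_left, inner_smul_left,
    RCLike.conj_ofReal, RCLike.conj_ofReal, RCLike.conj_ofReal, map_add, map_add,
    RCLike.re_ofReal_mul, RCLike.re_ofReal_mul, RCLike.re_ofReal_mul,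
    ← norm_sq_eq_re_inner (𝕜 := 𝕜)]
  set m := |α * κ - β / 2| with hm
  have hm0 : 0 ≤ m := abs_nonneg _
  have h1 : (α * κ - β / 2) * ‖trace u‖ ^ 2 ≤ m * (2 * (‖v‖ * ‖u‖)) :=
    (mul_le_mul_of_nonneg_right (le_abs_self _) (by positivity)).trans
      (mul_le_mul_of_nonneg_left e3 hm0)
  -- Young's inequality
  have h2 : m * (2 * (‖v‖ * ‖u‖)) ≤ α / 2 * ‖v‖ ^ 2 + 2 * m ^ 2 / α * ‖u‖ ^ 2 := by
    have h3 : α / 2 * ‖v‖ ^ 2 + 2 * m ^ 2 / α * ‖u‖ ^ 2 - m * (2 * (‖v‖ * ‖u‖))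
        = (α * ‖v‖ - 2 * m * ‖u‖) ^ 2 / (2 * α) := by
      field_simp
      ring
    have h4 : 0 ≤ (α * ‖v‖ - 2 * m * ‖u‖) ^ 2 / (2 * α) := by positivity
    linarith
  have h5 : RCLike.re (inner 𝕜 z u) = κ * ‖trace u‖ ^ 2 - ‖v‖ ^ 2 := by linarith
  have h6 : RCLike.re (inner 𝕜 v u) = -‖trace u‖ ^ 2 / 2 := by linarith
  rw [h5, h6, robinBound, ← hm]
  nlinarith [h1, h2]

lemma robinOperator_quasiDissipative {α β γ κ : ℝ} (hα : 0 < α) (l : ℝ)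
    (u : (robinOperator 𝕜 α β γ κ).domain) :
    (l - robinBound α β γ κ) * ‖(u : L2 𝕜)‖
      ≤ ‖(l : 𝕜) • (u : L2 𝕜) - robinOperator 𝕜 α β γ κ u‖ := by
  have h1 := re_inner_robinOperator_add_le hα u
  have h2 : 0 ≤ α / 2 * ‖weakDeriv (u : L2 𝕜)‖ ^ 2 := by positivity
  have h3 := (RCLike.re_le_norm _).trans
    (norm_inner_le_norm (𝕜 := 𝕜) ((l : 𝕜) • (u : L2 𝕜) - robinOperator 𝕜 α β γ κ u) (u : L2 𝕜))
  rw [inner_sub_left, inner_smul_left, RCLike.conj_ofReal, map_sub, RCLike.re_ofReal_mul,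
    ← norm_sq_eq_re_inner (𝕜 := 𝕜)] at h3
  rcases (norm_nonneg (u : L2 𝕜)).eq_or_lt with h0 | h0
  · rw [← h0, mul_zero]
    exact norm_nonneg _
  · refine le_of_mul_le_mul_right ?_ h0
    nlinarith

lemma exists_norm_weakDeriv_le {α β γ κ : ℝ} (hα : 0 < α) :
    ∃ C : ℝ, 0 < C ∧ ∀ u : (robinOperator 𝕜 α β γ κ).domain,
      ‖weakDeriv (u : L2 𝕜)‖ ≤ C * (‖(u : L2 𝕜)‖ + ‖robinOperator 𝕜 α β γ κ u‖) := by
  set w := robinBound α β γ κ with hw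
  set K := 2 * (|w| + 1) / α with hK
  have hK0 : 0 < K := by positivity
  refine ⟨K + 1, by positivity, fun u => ?_⟩
  have h1 := re_inner_robinOperator_add_le hα u
  have h2 := (abs_le.mp (RCLike.abs_re_le_norm
    (inner 𝕜 (robinOperator 𝕜 α β γ κ u) (u : L2 𝕜)))).1
  have h3 := norm_inner_le_norm (𝕜 := 𝕜) (robinOperator 𝕜 α β γ κ u) (u : L2 𝕜)
  have h4 : w * ‖(u : L2 𝕜)‖ ^ 2 ≤ |w| * ‖(u : L2 𝕜)‖ ^ 2 :=
    mul_le_mul_of_nonneg_right (le_abs_self w) (by positivity)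
  rw [← hw] at h1
  set U := ‖(u : L2 𝕜)‖
  set N := ‖robinOperator 𝕜 α β γ κ u‖
  set D := ‖weakDeriv (u : L2 𝕜)‖
  have hU : 0 ≤ U := norm_nonneg _
  have hN : 0 ≤ N := norm_nonneg _
  have hD : 0 ≤ D := norm_nonneg _
  have h5 : α / 2 * D ^ 2 ≤ (|w| + 1) * (U + N) ^ 2 := by
    nlinarith [mul_nonneg hU hN, mul_nonneg (abs_nonneg w) (mul_nonneg hU hN),
      mul_nonneg (abs_nonneg w) (sq_nonneg N), sq_nonneg U, sq_nonneg N]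
  have h6 : D ^ 2 ≤ K * (U + N) ^ 2 := by
    rw [hK, div_mul_eq_mul_div, le_div_iff₀ hα]
    linarith
  refine le_of_sq_le_sq ?_ (by positivity)
  nlinarith [sq_nonneg (U + N), mul_nonneg (sq_nonneg K) (sq_nonneg (U + N)),
    mul_nonneg hK0.le (sq_nonneg (U + N))]

lemma robinOperator_isClosed {α β γ κ : ℝ} (hα : 0 < α) :
    (robinOperator 𝕜 α β γ κ).IsClosed := by
  refine IsSeqClosed.isClosed ?_
  rintro p ⟨x, y⟩ hp hlim
  choose u hux huy using fun n => (LinearPMap.mem_graph_iff _).mp (hp n)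
  have hu : Tendsto (fun n => (u n : L2 𝕜)) atTop (𝓝 x) := by
    have := (continuous_fst.tendsto _).comp hlim
    exact this.congr fun n => (hux n).symm
  have hAu : Tendsto (fun n => robinOperator 𝕜 α β γ κ (u n)) atTop (𝓝 y) := by
    have := (continuous_snd.tendsto _).comp hlim
    exact this.congr fun n => (huy n).symm
  have hd1 : ∀ n, IsWeakDeriv (u n : L2 𝕜) (weakDeriv (u n : L2 𝕜)) :=
    fun n => isWeakDeriv_weakDeriv (u n).2.1.1
  have hd2 : ∀ n, IsWeakDeriv (weakDeriv (u n : L2 𝕜)) (weakDeriv (weakDeriv (u n : L2 𝕜))) :=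
    fun n => isWeakDeriv_weakDeriv (u n).2.1.2
  -- the energy estimate makes the first derivatives converge
  obtain ⟨C, hC, hCu⟩ := exists_norm_weakDeriv_le (𝕜 := 𝕜) (β := β) (γ := γ) (κ := κ) hα
  have hcau : CauchySeq fun n => weakDeriv (u n : L2 𝕜) := by
    have h1 := hu.cauchySeq
    have h2 := hAu.cauchySeq
    rw [Metric.cauchySeq_iff] at h1 h2 ⊢
    intro ε hε
    obtain ⟨N, hN⟩ := h1 (ε / (2 * C)) (by positivity)
    obtain ⟨M, hM⟩ := h2 (ε / (2 * C)) (by positivity)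
    refine ⟨max N M, fun m hm n hn => ?_⟩
    have h3 := hN m (le_of_max_le_left hm) n (le_of_max_le_left hn)
    have h4 := hM m (le_of_max_le_right hm) n (le_of_max_le_right hn)
    have h5 := hCu (u m - u n)
    have h6 : weakDeriv ((u m - u n : (robinOperator 𝕜 α β γ κ).domain) : L2 𝕜)
        = weakDeriv (u m : L2 𝕜) - weakDeriv (u n : L2 𝕜) := by
      have h7 := (hd1 m).add ((hd1 n).smul (-1))
      rw [neg_one_smul, neg_one_smul, ← sub_eq_add_neg, ← sub_eq_add_neg] at h7
      exact h7.weakDeriv_eq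
    rw [h6, LinearPMap.map_sub, Submodule.coe_sub, ← dist_eq_norm, ← dist_eq_norm,
      ← dist_eq_norm] at h5
    refine h5.trans_lt ?_
    calc C * (dist (u m : L2 𝕜) (u n) + dist (robinOperator 𝕜 α β γ κ (u m)) (robinOperator 𝕜 α β γ κ (u n)))
        < C * (ε / (2 * C) + ε / (2 * C)) := by gcongr
      _ = ε := by field_simp; ring
  obtain ⟨v, hv⟩ := cauchySeq_tendsto_of_complete hcau
  have hα' : (α : 𝕜) ≠ 0 := by exact_mod_cast hα.ne'
  have hz : Tendsto (fun n => weakDeriv (weakDeriv (u n : L2 𝕜))) atTop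
      (𝓝 ((α : 𝕜)⁻¹ • (y - (β : 𝕜) • v - (γ : 𝕜) • x))) := by
    refine (((hAu.sub (hv.const_smul (β : 𝕜))).sub (hu.const_smul (γ : 𝕜))).const_smul
      (α : 𝕜)⁻¹).congr fun n => ?_
    rw [inv_smul_eq_iff₀ hα', robinOperator_apply]
    abel
  set z := (α : 𝕜)⁻¹ • (y - (β : 𝕜) • v - (γ : 𝕜) • x) with hzdef
  have hxv : IsWeakDeriv x v := IsWeakDeriv.of_tendsto hd1 hu hv
  have hvz : IsWeakDeriv v z := IsWeakDeriv.of_tendsto hd2 hv hz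
  have hbc : trace v + (κ : 𝕜) * trace x = 0 := by
    have h1 := (IsWeakDeriv.tendsto_trace hd2 hv hz).add
      ((IsWeakDeriv.tendsto_trace hd1 hu hv).const_mul (κ : 𝕜))
    refine tendsto_nhds_unique h1 (tendsto_const_nhds.congr fun n => ?_)
    exact (u n).2.2.symm
  have hx : x ∈ (robinOperator 𝕜 α β γ κ).domain := by
    refine ⟨⟨⟨v, hxv⟩, ?_⟩, ?_⟩
    · rw [hxv.weakDeriv_eq]
      exact ⟨z, hvz⟩
    · rw [hxv.weakDeriv_eq]
      exact hbc
  refine (LinearPMap.mem_graph_iff _).mpr ⟨⟨x, hx⟩, rfl, ?_⟩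
  rw [robinOperator_apply]
  simp only
  rw [hxv.weakDeriv_eq, hvz.weakDeriv_eq, hzdef, smul_inv_smul₀ hα']
  abel

/-! ### Classical functions in the domain of the Robin operator -/

lemma isWeakDeriv_realToL2 {f f' : ℝ → ℝ} (hd : ∀ x, HasDerivAt f (f' x) x) (hc : Continuous f')
    (hf : MemLp f 2 (volume.restrict (Ioi 0))) (hf' : MemLp f' 2 (volume.restrict (Ioi 0))) :
    IsWeakDeriv (realToL2 𝕜 f hf) (realToL2 𝕜 f' hf') := by
  have hfc : Continuous f := continuous_iff_continuousAt.mpr fun x => (hd x).continuousAt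
  have hreal : ∀ (ψ g : ℝ → ℝ) (hg : MemLp g 2 (volume.restrict (Ioi 0))), tsupport ψ ⊆ Ioi 0 →
      ∫ x in Ioi (0 : ℝ), ψ x • realToL2 𝕜 g hg x = ((∫ x, ψ x * g x : ℝ) : 𝕜) := by
    intro ψ g hg hψ
    have h1 : ∫ x in Ioi (0 : ℝ), ψ x * g x = ∫ x, ψ x * g x := by
      refine setIntegral_eq_integral_of_forall_compl_eq_zero fun x hx => ?_
      rw [image_eq_zero_of_notMem_tsupport fun h => hx (hψ h), zero_mul]
    rw [← h1, ← integral_ofReal]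
    refine integral_congr_ae ?_
    filter_upwards [coeFn_realToL2 (𝕜 := 𝕜) hg] with x hx
    rw [hx, RCLike.real_smul_eq_coe_mul, RCLike.ofReal_mul]
  intro φ hφ hφc hφs
  have hφd : Continuous (deriv φ) := hφ.continuous_deriv (by simp)
  rw [hreal _ _ hf ((tsupport_deriv_subset (𝕜 := ℝ)).trans hφs), hreal _ _ hf' hφs,
    ← RCLike.ofReal_neg]
  congr 1
  have hi : ∀ ψ g : ℝ → ℝ, Continuous ψ → HasCompactSupport ψ → Continuous g →
      Integrable (ψ * g) := fun ψ g hψ hψc hg =>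
    (hψ.mul hg).integrable_of_hasCompactSupport hψc.mul_right
  have h := integral_mul_deriv_eq_deriv_mul_of_integrable (u := φ) (v := f) (u' := deriv φ)
    (v' := f') (fun x _ => (hφ.differentiable (by simp) x).hasDerivAt) (fun x _ => hd x)
    (hi _ _ hφ.continuous hφc hc) (hi _ _ hφd hφc.deriv hfc) (hi _ _ hφ.continuous hφc hfc)
  rw [h, neg_neg]

lemma trace_realToL2 {f : ℝ → ℝ} (hc : Continuous f) (hf : MemLp f 2 (volume.restrict (Ioi 0))) :
    trace (realToL2 𝕜 f hf) = (f 0 : 𝕜) :=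
  HasTrace.trace_eq ⟨fun x => (f x : 𝕜), (RCLike.continuous_ofReal.comp hc).continuousOn,
    coeFn_realToL2 hf, rfl⟩

/-- A `C²` function that is square-integrable together with its first two derivatives and satisfies
the Robin boundary condition lies in the domain of the Robin operator, which acts on it
classically. -/
lemma exists_mem_domain_of_classical {α β γ κ : ℝ} {u u₁ u₂ g : ℝ → ℝ}
    (hd : ∀ x, HasDerivAt u (u₁ x) x) (hd₁ : ∀ x, HasDerivAt u₁ (u₂ x) x) (hc : Continuous u₂)
    (hu : MemLp u 2 (volume.restrict (Ioi 0))) (hu₁ : MemLp u₁ 2 (volume.restrict (Ioi 0)))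
    (hu₂ : MemLp u₂ 2 (volume.restrict (Ioi 0))) (hbc : u₁ 0 + κ * u 0 = 0)
    (hg : MemLp g 2 (volume.restrict (Ioi 0))) (hug : ∀ x, α * u₂ x + β * u₁ x + γ * u x = g x) :
    ∃ v : (robinOperator 𝕜 α β γ κ).domain, (v : L2 𝕜) = realToL2 𝕜 u hu ∧
      robinOperator 𝕜 α β γ κ v = realToL2 𝕜 g hg := by
  have hc₁ : Continuous u₁ := continuous_iff_continuousAt.mpr fun x => (hd₁ x).continuousAt
  have hc₀ : Continuous u := continuous_iff_continuousAt.mpr fun x => (hd x).continuousAt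
  have hw := isWeakDeriv_realToL2 (𝕜 := 𝕜) hd hc₁ hu hu₁
  have hw₁ := isWeakDeriv_realToL2 (𝕜 := 𝕜) hd₁ hc hu₁ hu₂
  have hmem : realToL2 𝕜 u hu ∈ (robinOperator 𝕜 α β γ κ).domain := by
    refine ⟨⟨⟨_, hw⟩, ?_⟩, ?_⟩
    · rw [hw.weakDeriv_eq]
      exact ⟨_, hw₁⟩
    · rw [hw.weakDeriv_eq, trace_realToL2 hc₁, trace_realToL2 hc₀]
      exact_mod_cast hbc
  refine ⟨⟨_, hmem⟩, rfl, ?_⟩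
  rw [robinOperator_apply]
  simp only
  rw [hw.weakDeriv_eq, hw₁.weakDeriv_eq]
  refine Lp.ext ?_
  filter_upwards [Lp.coeFn_add ((α : 𝕜) • realToL2 𝕜 u₂ hu₂ + (β : 𝕜) • realToL2 𝕜 u₁ hu₁)
      ((γ : 𝕜) • realToL2 𝕜 u hu),
    Lp.coeFn_add ((α : 𝕜) • realToL2 𝕜 u₂ hu₂) ((β : 𝕜) • realToL2 𝕜 u₁ hu₁),
    Lp.coeFn_smul (α : 𝕜) (realToL2 𝕜 u₂ hu₂), Lp.coeFn_smul (β : 𝕜) (realToL2 𝕜 u₁ hu₁),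
    Lp.coeFn_smul (γ : 𝕜) (realToL2 𝕜 u hu), coeFn_realToL2 (𝕜 := 𝕜) hu,
    coeFn_realToL2 (𝕜 := 𝕜) hu₁, coeFn_realToL2 (𝕜 := 𝕜) hu₂, coeFn_realToL2 (𝕜 := 𝕜) hg]
    with x h1 h2 h3 h4 h5 h6 h7 h8 h9
  rw [h1, Pi.add_apply, h2, Pi.add_apply, h3, h4, h5, Pi.smul_apply, Pi.smul_apply, Pi.smul_apply,
    h6, h7, h8, h9, ← hug x]
  simp only [smul_eq_mul]
  push_cast
  ring

lemma robinOperator_dense_domain {α β γ κ : ℝ} :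
    Dense ((robinOperator 𝕜 α β γ κ).domain : Set (L2 𝕜)) := by
  refine dense_of_forall_test_mem fun φ hφ hc hs h => ?_
  have hφ1 : ContDiff ℝ ∞ (deriv φ) := (contDiff_infty_iff_deriv.mp hφ).2
  have hφ2 : Continuous (deriv (deriv φ)) := hφ1.continuous_deriv (by simp)
  have h0 : ∀ ψ : ℝ → ℝ, tsupport ψ ⊆ Ioi 0 → ψ 0 = 0 := fun ψ hψ =>
    image_eq_zero_of_notMem_tsupport fun h => lt_irrefl (0 : ℝ) (hψ h)
  have hg : Continuous fun x => α * deriv (deriv φ) x + β * deriv φ x + γ * φ x :=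
    ((hφ2.const_mul α).add (hφ1.continuous.const_mul β)).add (hφ.continuous.const_mul γ)
  have hgc : HasCompactSupport fun x => α * deriv (deriv φ) x + β * deriv φ x + γ * φ x :=
    ((hc.deriv.deriv.mul_left (f := fun _ => α)).add (hc.deriv.mul_left (f := fun _ => β))).add
      (hc.mul_left (f := fun _ => γ))
  obtain ⟨v, hv, -⟩ := exists_mem_domain_of_classical (𝕜 := 𝕜) (α := α) (β := β) (γ := γ) (κ := κ)
    (u := φ) (fun x => (hφ.differentiable (by simp) x).hasDerivAt)
    (fun x => (hφ1.differentiable (by simp) x).hasDerivAt) hφ2 h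
    (memLp_of_hasCompactSupport hφ1.continuous hc.deriv)
    (memLp_of_hasCompactSupport hφ2 hc.deriv.deriv)
    (by rw [h0 φ hs, h0 _ ((tsupport_deriv_subset (𝕜 := ℝ)).trans hs)]; simp)
    (memLp_of_hasCompactSupport hg hgc) fun x => rfl
  rw [← hv]
  exact v.2

/-! ### Solving the resolvent equation for test functions -/

/-- Variation of constants: a solution of `w' = r w + g`, `w 0 = c`, and its form beyond the support
of `g`. -/
lemma exists_hasDerivAt_linear (r c : ℝ) {g : ℝ → ℝ} (hg : Continuous g) {b : ℝ}
    (hgb : ∀ x, b ≤ x → g x = 0) :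
    ∃ w : ℝ → ℝ, (∀ x, HasDerivAt w (r * w x + g x) x) ∧ w 0 = c ∧
      ∀ x, b ≤ x → w x = (c + ∫ s in (0 : ℝ)..b, Real.exp (-r * s) * g s) * Real.exp (r * x) := by
  have hh : Continuous fun s => Real.exp (-r * s) * g s := by fun_prop
  refine ⟨fun x => (c + ∫ s in (0 : ℝ)..x, Real.exp (-r * s) * g s) * Real.exp (r * x),
    fun x => ?_, by simp, fun x hx => ?_⟩
  · have h1 : HasDerivAt (fun x => c + ∫ s in (0 : ℝ)..x, Real.exp (-r * s) * g s)
        (Real.exp (-r * x) * g x) x :=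
      (intervalIntegral.integral_hasDerivAt_right (hh.intervalIntegrable _ _)
        (hh.stronglyMeasurableAtFilter _ _) hh.continuousAt).const_add c
    have h2 : HasDerivAt (fun x => Real.exp (r * x)) (Real.exp (r * x) * r) x := by
      simpa using ((hasDerivAt_id x).const_mul r).exp
    refine (h1.mul h2).congr_deriv ?_
    have h3 : Real.exp (-r * x) * Real.exp (r * x) = 1 := by
      rw [← Real.exp_add]
      simp
    linear_combination g x * h3
  · simp only
    congr 2
    rw [← intervalIntegral.integral_add_adjacent_intervals (hh.intervalIntegrable 0 b)
      (hh.intervalIntegrable b x), add_eq_left]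
    refine (intervalIntegral.integral_congr (g := fun _ => (0 : ℝ)) fun s hs => ?_).trans (by simp)
    rw [uIcc_of_le hx] at hs
    simp only
    rw [hgb s hs.1, mul_zero]

lemma memLp_of_eq_const_mul_exp {f : ℝ → ℝ} (hf : Continuous f) {b C r : ℝ} (hb : 0 ≤ b)
    (hr : r < 0) (h : ∀ x, b ≤ x → f x = C * Real.exp (r * x)) :
    MemLp f 2 (volume.restrict (Ioi 0)) := by
  rw [memLp_two_iff_integrable_sq hf.aestronglyMeasurable]
  change IntegrableOn (fun x => f x ^ 2) (Ioi 0)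
  rw [← Ioc_union_Ioi_eq_Ioi hb]
  refine IntegrableOn.union ?_ ?_
  · exact ((hf.pow 2).integrableOn_Icc).mono_set Ioc_subset_Icc_self
  · have h1 : IntegrableOn (fun x => C ^ 2 * Real.exp (2 * r * x)) (Ioi b) :=
      (integrableOn_exp_mul_Ioi (by linarith) b).const_mul _
    refine h1.congr_fun (fun x hx => ?_) measurableSet_Ioi
    simp only
    rw [h x (le_of_lt hx), mul_pow, ← Real.exp_nat_mul]
    congr 2
    push_cast
    ring

/-- Factoring the differential operator as `α (d/dx - r₁) (d/dx - r₂)` with `r₂ < 0`, the equation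
`α (d/dx - r₁) (d/dx - r₂) u = -φ` is solved by two first-order equations. The free constant in the
first one is chosen such that its solution vanishes beyond the support of `φ`, the one in the second
such that the boundary condition holds. -/
lemma exists_classical_solution {α κ r₁ r₂ : ℝ} (hα : α ≠ 0) (hr : r₂ < 0) (hκ : r₂ + κ ≠ 0)
    {φ : ℝ → ℝ} (hφ : Continuous φ) (hφc : HasCompactSupport φ) :
    ∃ u u₁ u₂ : ℝ → ℝ, (∀ x, HasDerivAt u (u₁ x) x) ∧ (∀ x, HasDerivAt u₁ (u₂ x) x) ∧
      Continuous u₂ ∧ MemLp u 2 (volume.restrict (Ioi 0)) ∧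
      MemLp u₁ 2 (volume.restrict (Ioi 0)) ∧ MemLp u₂ 2 (volume.restrict (Ioi 0)) ∧
      u₁ 0 + κ * u 0 = 0 ∧ ∀ x, α * u₂ x - α * (r₁ + r₂) * u₁ x + α * r₁ * r₂ * u x = -φ x := by
  obtain ⟨b, hb, hφb⟩ : ∃ b : ℝ, 0 ≤ b ∧ ∀ x, b ≤ x → φ x = 0 := by
    obtain ⟨R, hR⟩ := (show IsCompact (tsupport φ) from hφc).bddAbove
    refine ⟨max 0 (R + 1), le_max_left _ _, fun x hx => image_eq_zero_of_notMem_tsupport fun h => ?_⟩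
    have h1 := hR h
    have h2 := (le_max_right 0 (R + 1)).trans hx
    linarith
  have hg : Continuous fun x => -φ x / α := by fun_prop
  have hgb : ∀ x, b ≤ x → -φ x / α = 0 := fun x hx => by rw [hφb x hx]; simp
  obtain ⟨w, hw, hw0, hwb⟩ := exists_hasDerivAt_linear r₁
    (-∫ s in (0 : ℝ)..b, Real.exp (-r₁ * s) * (-φ s / α)) hg hgb
  have hwb0 : ∀ x, b ≤ x → w x = 0 := fun x hx => by rw [hwb x hx, neg_add_cancel, zero_mul]
  have hwc : Continuous w := continuous_iff_continuousAt.mpr fun x => (hw x).continuousAt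
  obtain ⟨u, hu, hu0, hub⟩ := exists_hasDerivAt_linear r₂ (-w 0 / (r₂ + κ)) hwc hwb0
  have huc : Continuous u := continuous_iff_continuousAt.mpr fun x => (hu x).continuousAt
  set C := -w 0 / (r₂ + κ) + ∫ s in (0 : ℝ)..b, Real.exp (-r₂ * s) * w s
  refine ⟨u, fun x => r₂ * u x + w x,
    fun x => r₂ * (r₂ * u x + w x) + (r₁ * w x + -φ x / α), hu,
    fun x => ((hu x).const_mul r₂).add (hw x), by fun_prop,
    memLp_of_eq_const_mul_exp huc hb hr hub,
    memLp_of_eq_const_mul_exp (C := r₂ * C) (by fun_prop) hb hr fun x hx => ?_,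
    memLp_of_eq_const_mul_exp (C := r₂ ^ 2 * C) (by fun_prop) hb hr fun x hx => ?_, ?_,
    fun x => ?_⟩
  · rw [hub x hx, hwb0 x hx]
    ring
  · rw [hub x hx, hwb0 x hx, hφb x hx]
    ring
  · have h1 : (r₂ + κ) * u 0 = -w 0 := by rw [hu0, mul_div_cancel₀ _ hκ]
    linear_combination h1
  · field_simp
    ring

/-- For large `l` the characteristic polynomial `α r² + β r + (γ - l)` has a root `r₂ < 0` with
`r₂ ≠ -κ`. -/
lemma exists_characteristic_roots {α : ℝ} (hα : 0 < α) (β γ κ : ℝ) {l : ℝ}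
    (hl : γ + |α * κ ^ 2 - β * κ| < l) :
    ∃ r₁ r₂ : ℝ, r₂ < 0 ∧ r₂ + κ ≠ 0 ∧ -(α * (r₁ + r₂)) = β ∧ α * r₁ * r₂ = γ - l := by
  set Δ := β ^ 2 + 4 * α * (l - γ) with hΔ
  have h0 : 0 ≤ |α * κ ^ 2 - β * κ| := abs_nonneg _
  have h1 : β ^ 2 < Δ := by
    have : 0 < 4 * α * (l - γ) := by
      have : 0 < l - γ := by linarith
      positivity
    linarith
  have h2 : (2 * α * κ - β) ^ 2 < Δ := by
    have h3 : α * κ ^ 2 - β * κ < l - γ := by linarith [le_abs_self (α * κ ^ 2 - β * κ)]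
    have h4 := mul_lt_mul_of_pos_left h3 (by positivity : 0 < 4 * α)
    rw [hΔ]
    linarith
  have h3 : -β < √Δ := (neg_le_abs β).trans_lt (Real.lt_sqrt_of_sq_lt (by rwa [sq_abs]))
  have h4 : 2 * α * κ - β < √Δ :=
    (le_abs_self _).trans_lt (Real.lt_sqrt_of_sq_lt (by rwa [sq_abs]))
  have h5 : √Δ ^ 2 = Δ := Real.sq_sqrt ((sq_nonneg β).trans h1.le)
  refine ⟨(-β + √Δ) / (2 * α), (-β - √Δ) / (2 * α), ?_, ?_, ?_, ?_⟩
  · exact div_neg_of_neg_of_pos (by linarith) (by positivity)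
  · have h6 : (-β - √Δ) / (2 * α) < -κ := by
      rw [div_lt_iff₀ (by positivity)]
      linarith
    linarith
  · field_simp
    ring
  · field_simp
    rw [hΔ] at h5
    linear_combination (-1) * h5

lemma robinOperator_dense_range {α β γ κ : ℝ} (hα : 0 < α) {l : ℝ}
    (hl : γ + |α * κ ^ 2 - β * κ| < l) :
    Dense (range fun u : (robinOperator 𝕜 α β γ κ).domain =>
      (l : 𝕜) • (u : L2 𝕜) - robinOperator 𝕜 α β γ κ u) := by
  let M : (robinOperator 𝕜 α β γ κ).domain →ₗ[𝕜] L2 𝕜 :=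
    (l : 𝕜) • (robinOperator 𝕜 α β γ κ).domain.subtype - (robinOperator 𝕜 α β γ κ).toFun
  refine dense_of_forall_test_mem (V := LinearMap.range M) fun φ hφ hc hs h => ?_
  obtain ⟨r₁, r₂, hr, hκ, hβ, hγ⟩ := exists_characteristic_roots hα β γ κ hl
  obtain ⟨u, u₁, u₂, hd, hd₁, hc₂, hu, hu₁, hu₂, hbc, hsol⟩ :=
    exists_classical_solution (r₁ := r₁) hα.ne' hr hκ hφ.continuous hc
  have hg : MemLp (fun x => l * u x - φ x) 2 (volume.restrict (Ioi 0)) := (hu.const_mul l).sub h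
  obtain ⟨v, hv, hAv⟩ := exists_mem_domain_of_classical (𝕜 := 𝕜) (α := α) (β := β) (γ := γ)
    (κ := κ) hd hd₁ hc₂ hu hu₁ hu₂ hbc hg fun x => by
      linear_combination hsol x - u₁ x * hβ - u x * hγ
  refine ⟨v, ?_⟩
  change (l : 𝕜) • (v : L2 𝕜) - robinOperator 𝕜 α β γ κ v = _
  rw [hv, hAv]
  refine Lp.ext ?_
  filter_upwards [Lp.coeFn_sub ((l : 𝕜) • realToL2 𝕜 u hu) (realToL2 𝕜 _ hg),
    Lp.coeFn_smul (l : 𝕜) (realToL2 𝕜 u hu), coeFn_realToL2 (𝕜 := 𝕜) hu,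
    coeFn_realToL2 (𝕜 := 𝕜) hg, coeFn_realToL2 (𝕜 := 𝕜) h] with x h1 h2 h3 h4 h5
  rw [h1, Pi.sub_apply, h2, Pi.smul_apply, h3, h4, h5, smul_eq_mul]
  push_cast
  ring

end HalfLine

end

theorem mainTheorem8 {𝕜 : Type*} [RCLike 𝕜] (α β γ κ : ℝ) (hα : 0 < α) :
    Dense ((HalfLine.robinOperator 𝕜 α β γ κ).domain : Set (HalfLine.L2 𝕜)) ∧
      (HalfLine.robinOperator 𝕜 α β γ κ).IsClosed ∧
      GeneratesC0Semigroup (HalfLine.robinOperator 𝕜 α β γ κ) :=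
  ⟨HalfLine.robinOperator_dense_domain, HalfLine.robinOperator_isClosed hα,
    generatesC0Semigroup_of_quasiDissipative HalfLine.robinOperator_dense_domain
      (HalfLine.robinOperator_isClosed hα)
      (fun l _ u => HalfLine.robinOperator_quasiDissipative hα l u)
      fun _ hl => HalfLine.robinOperator_dense_range hα hl⟩
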